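/- Let $(X,\mathcal B,\mu)$ be a standard (non-atomic) Lebesgue probability space and let $\mathrm{Aut}$ be the group of its invertible measure-preserving transformations, transformations that differ on a set of measure $0$ being identified. Let $\{A_i\}_{i\ge 1}$ be a sequence of measurable sets that is dense in $\mathcal B$ with respect to the distance $\mu(A\Delta B)$, and equip $\mathrm{Aut}$ with the Halmos metric $$\rho(S,T)=\sum_{i\ge 1}2^{-i}\bigl(\mu(SA_i\Delta TA_i)+\mu(S^{-1}A_i\Delta T^{-1}A_i)\bigr).$$ For a finite measurable partition $\xi=\{C_1,\dots,C_n\}$ put $H(\xi)=-\sum_k\mu(C_k)\ln\mu(C_k)$, and let $$h(T)=\sup_\xi\limsup_{j\to\infty}\frac1{j+1}H\Bigl(\bigvee_{p=0}^{j}T^p\xi\Bigr)$$ be the entropy of $T\in\mathrm{Aut}$. A subset of $\mathrm{Aut}$ is called typical if its complement is of the first category, i.e. a countable union of nowhere dense sets, in $(\mathrm{Aut},\rho)$. **Theorem 7.2.** If $K\subset\{T\in\mathrm{Aut}: h(T)=0\}$ is compact in $(\mathrm{Aut},\rho)$, then the set $$K^{\mathrm{Aut}}=\{J^{-1}SJ:\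 S\in K,\ J\in\mathrm{Aut}\}$$ is of the first category, and it is not typical. -/

import Mathlib

namespace ErgodicAut

open MeasureTheory Filter Set
open scoped symmDiff

variable {X : Type*} [MeasurableSpace X]

/-- Invertible bimeasurable maps `X → X` preserving `μ`, as a group under composition. -/
def mpGroup (μ : Measure X) : Subgroup (Equiv.Perm X) where
  carrier := {e | MeasurePreserving e μ μ ∧ MeasurePreserving e.symm μ μ}
  mul_mem' ha hb := ⟨ha.1.comp hb.1, hb.2.comp ha.2⟩
  one_mem' := ⟨MeasurePreserving.id μ, MeasurePreserving.id μ⟩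
  inv_mem' ha := ⟨ha.2, ha.1⟩

variable {μ : Measure X}

theorem mpGroup_mp (S : mpGroup μ) : MeasurePreserving (S : Equiv.Perm X) μ μ := S.2.1

theorem mpGroup_mp_inv (S : mpGroup μ) :
    MeasurePreserving ((S⁻¹ : mpGroup μ) : Equiv.Perm X) μ μ := S.2.2

/-- The transformations that coincide with the identity outside a null set. -/
def nullGroup (μ : Measure X) : Subgroup (mpGroup μ) where
  carrier := {e | ∀ᵐ x ∂μ, (e : Equiv.Perm X) x = x}
  mul_mem' {a b} ha hb := by
    have h := (mpGroup_mp b).quasiMeasurePreserving.ae ha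
    change ∀ᵐ x ∂μ, _
    filter_upwards [h, hb] with x h1 h2
    exact h1.trans h2
  one_mem' := by simp
  inv_mem' {a} ha := by
    have h := (mpGroup_mp_inv a).quasiMeasurePreserving.ae ha
    change ∀ᵐ x ∂μ, _
    filter_upwards [h] with x h1
    simpa using h1.symm

instance nullGroup_normal (μ : Measure X) : (nullGroup μ).Normal where
  conj_mem n hn g := by
    have h := (mpGroup_mp_inv g).quasiMeasurePreserving.ae hn
    change ∀ᵐ x ∂μ, _
    filter_upwards [h] with x h1
    simp only [Subgroup.coe_mul, Equiv.Perm.coe_mul, Function.comp_apply, h1]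
    simp

/-- The group of automorphisms of the measure space `(X, μ)`: invertible measure-preserving
transformations, those that differ on a null set being identified. -/
abbrev Aut (μ : Measure X) : Type _ := mpGroup μ ⧸ nullGroup μ

/-- Two transformations define the same automorphism iff they agree almost everywhere. -/
theorem mk_eq_mk_iff (S T : mpGroup μ) :
    ((S : Aut μ) = (T : Aut μ)) ↔
      ∀ᵐ x ∂μ, (S : Equiv.Perm X) x = (T : Equiv.Perm X) x := by
  rw [QuotientGroup.eq]
  change (∀ᵐ x ∂μ, ((S⁻¹ * T : mpGroup μ) : Equiv.Perm X) x = x) ↔ _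
  refine eventually_congr (Eventually.of_forall fun x => ?_)
  simp only [Subgroup.coe_mul, Subgroup.coe_inv, Equiv.Perm.coe_mul, Function.comp_apply]
  rw [Equiv.Perm.inv_eq_iff_eq]
  exact eq_comm

theorem inv_ae_eq {S T : mpGroup μ} (h : (S : Aut μ) = (T : Aut μ)) :
    ∀ᵐ x ∂μ, ((S⁻¹ : mpGroup μ) : Equiv.Perm X) x = ((T⁻¹ : mpGroup μ) : Equiv.Perm X) x := by
  rw [← mk_eq_mk_iff, QuotientGroup.mk_inv, QuotientGroup.mk_inv, h]

theorem image_ae_eq {S T : mpGroup μ} (h : (S : Aut μ) = (T : Aut μ)) (B : Set X) :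
    ((S : Equiv.Perm X) '' B : Set X) =ᵐ[μ] ((T : Equiv.Perm X) '' B : Set X) := by
  rw [Equiv.image_eq_preimage_symm, Equiv.image_eq_preimage_symm]
  filter_upwards [inv_ae_eq h] with x hx
  exact congrArg (· ∈ B) hx

/-- `μ(SB ∆ TB)` for automorphisms `S`, `T` and a set `B`. -/
noncomputable def moveDist (B : Set X) (S T : Aut μ) : ℝ :=
  Quotient.liftOn₂' S T
    (fun S T => μ.real (((S : Equiv.Perm X) '' B) ∆ ((T : Equiv.Perm X) '' B)))
    (fun S₁ T₁ S₂ T₂ hS hT => by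
      have h1 := image_ae_eq (Quotient.sound' hS : (S₁ : Aut μ) = S₂) B
      have h2 := image_ae_eq (Quotient.sound' hT : (T₁ : Aut μ) = T₂) B
      exact measureReal_congr (h1.symmDiff h2))

theorem moveDist_mk (B : Set X) (S T : mpGroup μ) :
    moveDist B (S : Aut μ) (T : Aut μ) =
      μ.real (((S : Equiv.Perm X) '' B) ∆ ((T : Equiv.Perm X) '' B)) := rfl

theorem moveDist_nonneg (B : Set X) (S T : Aut μ) : 0 ≤ moveDist B S T := by
  induction S using QuotientGroup.induction_on
  induction T using QuotientGroup.induction_on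
  exact measureReal_nonneg

theorem moveDist_le_one [IsProbabilityMeasure μ] (B : Set X) (S T : Aut μ) :
    moveDist B S T ≤ 1 := by
  induction S using QuotientGroup.induction_on
  induction T using QuotientGroup.induction_on
  exact measureReal_le_one

theorem moveDist_self (B : Set X) (S : Aut μ) : moveDist B S S = 0 := by
  induction S using QuotientGroup.induction_on
  simp [moveDist_mk]

theorem moveDist_comm (B : Set X) (S T : Aut μ) : moveDist B S T = moveDist B T S := by
  induction S using QuotientGroup.induction_on
  induction T using QuotientGroup.induction_on
  rw [moveDist_mk, moveDist_mk, symmDiff_comm]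

theorem moveDist_triangle [IsProbabilityMeasure μ] (B : Set X) (S T U : Aut μ) :
    moveDist B S U ≤ moveDist B S T + moveDist B T U := by
  induction S using QuotientGroup.induction_on
  induction T using QuotientGroup.induction_on
  induction U using QuotientGroup.induction_on
  exact measureReal_symmDiff_le _

/-- The Halmos distance `ρ(S,T) = ∑_{i ≥ 1} 2^{-i} (μ(SAᵢ ∆ TAᵢ) + μ(S⁻¹Aᵢ ∆ T⁻¹Aᵢ))` of a sequence
of measurable sets; the sequence is indexed from `0` here. -/
noncomputable def halmosDist (A : ℕ → MeasuredSets μ) (S T : Aut μ) : ℝ :=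
  ∑' i : ℕ, (1 / 2 : ℝ) ^ (i + 1) * (moveDist (A i : Set X) S T + moveDist (A i : Set X) S⁻¹ T⁻¹)

theorem halmos_summable [IsProbabilityMeasure μ] (A : ℕ → MeasuredSets μ) (S T : Aut μ) :
    Summable fun i : ℕ => (1 / 2 : ℝ) ^ (i + 1) *
      (moveDist (A i : Set X) S T + moveDist (A i : Set X) S⁻¹ T⁻¹) := by
  refine Summable.of_nonneg_of_le (f := fun i : ℕ => (1 / 2 : ℝ) ^ i) (fun i => ?_) (fun i => ?_)
    (summable_geometric_of_lt_one (by norm_num) (by norm_num))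
  · have := moveDist_nonneg (A i : Set X) S T
    have := moveDist_nonneg (A i : Set X) S⁻¹ T⁻¹
    positivity
  · have h1 := moveDist_le_one (A i : Set X) S T
    have h2 := moveDist_le_one (A i : Set X) S⁻¹ T⁻¹
    calc (1 / 2 : ℝ) ^ (i + 1) *
          (moveDist (A i : Set X) S T + moveDist (A i : Set X) S⁻¹ T⁻¹)
        ≤ (1 / 2 : ℝ) ^ (i + 1) * 2 := by gcongr; linarith
      _ = (1 / 2 : ℝ) ^ i := by ring

theorem eq_of_halmosDist_eq_zero [StandardBorelSpace X] [IsProbabilityMeasure μ]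
    (A : ℕ → MeasuredSets μ) (hA : DenseRange A) {S T : Aut μ} (h : halmosDist A S T = 0) :
    S = T := by
  have hnn : ∀ i : ℕ, 0 ≤ (1 / 2 : ℝ) ^ (i + 1) *
      (moveDist (A i : Set X) S T + moveDist (A i : Set X) S⁻¹ T⁻¹) := fun i => by
    have := moveDist_nonneg (A i : Set X) S T
    have := moveDist_nonneg (A i : Set X) S⁻¹ T⁻¹
    positivity
  have hs := (halmos_summable A S T).hasSum
  rw [← halmosDist, h] at hs
  have h0 := (hasSum_zero_iff_of_nonneg hnn).1 hs
  have h1 : ∀ i, moveDist (A i : Set X) S⁻¹ T⁻¹ = 0 := fun i => by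
    have h2 := congrFun h0 i
    have h3 := moveDist_nonneg (A i : Set X) S T
    have h4 := moveDist_nonneg (A i : Set X) S⁻¹ T⁻¹
    have h5 : (0 : ℝ) < (1 / 2 : ℝ) ^ (i + 1) := by positivity
    rcases mul_eq_zero.1 h2 with h6 | h6
    · exact absurd h6 h5.ne'
    · linarith
  clear h h0 hnn
  induction S using QuotientGroup.induction_on with | H S => ?_
  induction T using QuotientGroup.induction_on with | H T => ?_
  have key : ∀ (R : mpGroup μ) (B : Set X),
      ((R⁻¹ : mpGroup μ) : Equiv.Perm X) '' B = (R : Equiv.Perm X) ⁻¹' B := fun R B => by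
    rw [Equiv.image_eq_preimage_symm]; rfl
  have h2 : ∀ i, μ.real (((S : Equiv.Perm X) ⁻¹' (A i)) ∆ ((T : Equiv.Perm X) ⁻¹' (A i))) = 0 :=
    fun i => by
      have := h1 i
      rwa [← QuotientGroup.mk_inv, ← QuotientGroup.mk_inv, moveDist_mk, key, key] at this
  rw [mk_eq_mk_iff]
  refine EventuallyEq.of_forall_separating_preimage MeasurableSet fun U hU => ?_
  rw [← measure_symmDiff_eq_zero_iff, ← measureReal_eq_zero_iff]
  refine le_antisymm (le_of_forall_pos_le_add fun ε hε => ?_) measureReal_nonneg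
  obtain ⟨i, hi⟩ := Metric.denseRange_iff.1 hA ⟨U, hU⟩ (ε / 2) (by positivity)
  change μ.real (U ∆ (A i : Set X)) < ε / 2 at hi
  have hm : MeasurableSet (U ∆ (A i : Set X)) := hU.symmDiff (A i).2
  have hpre : ∀ R : mpGroup μ,
      μ.real (((R : Equiv.Perm X) ⁻¹' U) ∆ ((R : Equiv.Perm X) ⁻¹' (A i))) < ε / 2 := fun R => by
    rw [← preimage_symmDiff, (mpGroup_mp R).measureReal_preimage hm.nullMeasurableSet]
    exact hi
  have hS := hpre S
  have hT := hpre T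
  rw [symmDiff_comm] at hT
  have t1 := measureReal_symmDiff_le (μ := μ) (s := (S : Equiv.Perm X) ⁻¹' U)
    (t := (S : Equiv.Perm X) ⁻¹' (A i)) ((T : Equiv.Perm X) ⁻¹' U)
  have t2 := measureReal_symmDiff_le (μ := μ) (s := (S : Equiv.Perm X) ⁻¹' (A i))
    (t := (T : Equiv.Perm X) ⁻¹' (A i)) ((T : Equiv.Perm X) ⁻¹' U)
  have := h2 i
  linarith

/-- The metric space `(Aut, ρ)` of a sequence that is dense in the algebra of measurable sets with
the pseudometric `μ(B ∆ C)`. -/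
noncomputable abbrev halmosMetric [StandardBorelSpace X] [IsProbabilityMeasure μ]
    (A : ℕ → MeasuredSets μ) (hA : DenseRange A) : MetricSpace (Aut μ) where
  dist := halmosDist A
  dist_self S := by simp [halmosDist, moveDist_self]
  dist_comm S T := by
    unfold halmosDist
    congr 1
    funext i
    rw [moveDist_comm _ S T, moveDist_comm _ S⁻¹ T⁻¹]
  dist_triangle S T U := by
    unfold halmosDist
    rw [← (halmos_summable A S T).tsum_add (halmos_summable A T U)]
    refine (halmos_summable A S U).tsum_le_tsum (fun i => ?_)
      ((halmos_summable A S T).add (halmos_summable A T U))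
    rw [← mul_add]
    have h1 := moveDist_triangle (A i : Set X) S T U
    have h2 := moveDist_triangle (A i : Set X) S⁻¹ T⁻¹ U⁻¹
    exact mul_le_mul_of_nonneg_left (by linarith) (by positivity)
  eq_of_dist_eq_zero h := eq_of_halmosDist_eq_zero A hA h

/-- Entropy `H(ξ) = -∑ μ(C) ln μ(C)` of the finite partition `ξ` into the level sets `C` of `f`
(empty level sets contribute `0`). -/
noncomputable def partEntropy (μ : Measure X) {ι : Type*} [Fintype ι] (f : X → ι) : ℝ :=
  ∑ i, Real.negMulLog (μ.real (f ⁻¹' {i}))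

/-- For the partition `ξ` into level sets of `f`, the level sets of `joinLabel T P f` are the cells
of `⋁_{p ∈ P} T^p ξ`, where `T^p ξ = {T^p C : C ∈ ξ}`; note that `x ∈ T^p C` iff `T^{-p} x ∈ C`. -/
def joinLabel (T : mpGroup μ) (P : Finset ℤ) {n : ℕ} (f : X → Fin n) : X → (P → Fin n) :=
  fun x p => f (((T ^ (-(p : ℤ)) : mpGroup μ) : Equiv.Perm X) x)

/-- `H(⋁_{p ∈ P} T^p ξ)`, where `ξ` is the partition into level sets of `f`. -/
noncomputable def joinEntropy (T : Aut μ) (P : Finset ℤ) {n : ℕ} (f : X → Fin n) : ℝ :=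
  Quotient.liftOn' T (fun T => partEntropy μ (joinLabel T P f)) (fun S T h => by
    have h1 : (S : Aut μ) = T := Quotient.sound' h
    have h2 : ∀ p : P, ∀ᵐ x ∂μ, ((S ^ (-(p : ℤ)) : mpGroup μ) : Equiv.Perm X) x =
        ((T ^ (-(p : ℤ)) : mpGroup μ) : Equiv.Perm X) x := fun p => by
      rw [← mk_eq_mk_iff, QuotientGroup.mk_zpow, QuotientGroup.mk_zpow, h1]
    have h3 : ∀ᵐ x ∂μ, joinLabel S P f x = joinLabel T P f x := by
      filter_upwards [ae_all_iff.2 h2] with x hx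
      funext p
      exact congrArg f (hx p)
    refine Finset.sum_congr rfl fun i _ => congrArg Real.negMulLog (measureReal_congr ?_)
    filter_upwards [h3] with x hx
    exact congrArg (· ∈ ({i} : Set (P → Fin n))) hx)

/-- `h_P(T) = sup_ξ limsup_j |P_j|⁻¹ H(⋁_{p ∈ P_j} T^p ξ)`, the supremum being over all finite
measurable partitions `ξ`, given as level sets of measurable functions `X → {0, …, n - 1}`. -/
noncomputable def pEntropy (P : ℕ → Finset ℤ) (T : Aut μ) : EReal :=
  ⨆ (n : ℕ) (f : {f : X → Fin n // Measurable f}),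
    limsup (fun j : ℕ => ((joinEntropy T (P j) f.1 / ((P j).card : ℝ) : ℝ) : EReal)) atTop

/-- The Kolmogorov–Sinai entropy `h(T)`, i.e. `h_P(T)` for `P_j = {0, 1, …, j}`. -/
noncomputable def entropy (T : Aut μ) : EReal :=
  pEntropy (fun j : ℕ => Finset.Icc (0 : ℤ) j) T

/-- The class `E₀` of automorphisms of zero entropy. -/
def zeroEntropy (μ : Measure X) : Set (Aut μ) := {T | entropy T = 0}

/-- `K^Aut = {J⁻¹ S J : S ∈ K, J ∈ Aut}`. -/
def conjugates (K : Set (Aut μ)) : Set (Aut μ) :=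
  {T | ∃ S ∈ K, ∃ J : Aut μ, T = J⁻¹ * S * J}

/-- A set is typical if its complement is of the first category. -/
def IsTypical {Y : Type*} [TopologicalSpace Y] (s : Set Y) : Prop := IsMeagre sᶜ

end ErgodicAut

/-! The entropy per step along sparse arithmetic progressions separates conjugates of `K` from a
generic automorphism. Fix a step `j + 1`. Zero entropy makes `H(⋁ T^p ξ) / L`, with `p` over `{0, j
+ 1, …, (j + 1)(L - 1)}`, arbitrarily small for suitable `L`. This entropy depends continuously on
`T` (`continuous_joinEntropy`), so compactness gives one length `L j` that serves all of `K` and the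
partitions `{A i, (A i)ᶜ}` with `i ≤ j`, with bound `1 / (j + 1)` per step
(`exists_uniform_joinEntropy_lt`, `exists_progression_length`).

Conjugating by `J` replaces a set `B` by `J B`, and some `A i` approximates `J B`. Hence for every
conjugate the entropy of `{B, Bᶜ}` along the chosen progressions is `o(L j)`, although the lengths
do not depend on `J` (`eventually_joinEntropy_conj_le`).

Now let `μ B = 1/2`. The automorphisms whose entropy exceeds `L j * (log 2 / 2)` for infinitely many
`j` form a `Gδ` disjoint from the conjugates. It is dense, because near any `T₀` there is a `T` for
which the iterates of `{B, Bᶜ}` along all progressions with a large step are independent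
(`exists_halmosDist_lt_independent`). To build `T`, follow `T₀` but restart from a fresh random
point with small probability at each time, remembering only the last `N` steps. The state is then a
finite-range function on a Bernoulli shift. An isomorphism of the shift space with `X` can be chosen
to agree with that function on finitely many prescribed sets, and it carries the shift to `T`
(`exists_approx_independent`).

So the conjugates are meagre. Since the Halmos metric is complete (`completeSpace_halmosMetric`),
Baire's theorem excludes that they are also typical. -/

namespace ErgodicAut

open MeasureTheory Filter Set ProbabilityTheory
open scoped symmDiff Topology

/-! ### Shannon entropy of finite partitions and of their joins -/

section Entropy

set_option linter.unusedSectionVars false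

variable {Ω : Type*} [MeasurableSpace Ω] {P : Measure Ω} [IsProbabilityMeasure P]
variable {ι κ τ α : Type*} [Fintype ι] [Fintype κ] [Fintype τ]
  [MeasurableSpace ι] [MeasurableSingletonClass ι]
  [MeasurableSpace κ] [MeasurableSingletonClass κ]
  [MeasurableSpace τ] [MeasurableSingletonClass τ]

/-- Each `p i` is at most the sum, so `log` of the sum dominates every `log (p i)`. -/
theorem negMulLog_sum_le {s : Finset ι} {p : ι → ℝ} (hp : ∀ i, 0 ≤ p i) :
    Real.negMulLog (∑ i ∈ s, p i) ≤ ∑ i ∈ s, Real.negMulLog (p i) := by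
  simp only [Real.negMulLog]
  rw [neg_mul, Finset.sum_mul, ← Finset.sum_neg_distrib]
  refine Finset.sum_le_sum fun i hi => ?_
  rw [neg_mul, neg_le_neg_iff]
  rcases (hp i).eq_or_lt with h | h
  · simp [← h]
  · have : p i ≤ ∑ i ∈ s, p i := Finset.single_le_sum (fun j _ => hp j) hi
    exact mul_le_mul_of_nonneg_left (Real.log_le_log h this) h.le

theorem sum_measureReal_fiber_inter {f : Ω → ι} (hf : Measurable f) {s : Set Ω}
    (hs : MeasurableSet s) : ∑ i, P.real (f ⁻¹' {i} ∩ s) = P.real s := by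
  rw [← measureReal_biUnion_finset]
  · congr 1
    ext x
    simp
  · intro i _ j _ hij
    refine Set.disjoint_left.2 fun x hx hx' => hij ?_
    exact hx.1.symm.trans hx'.1
  · exact fun i _ => (hf (measurableSet_singleton i)).inter hs

theorem sum_measureReal_fiber {f : Ω → ι} (hf : Measurable f) :
    ∑ i, P.real (f ⁻¹' {i}) = 1 := by
  simpa using sum_measureReal_fiber_inter (P := P) hf MeasurableSet.univ

/-- Coarsening a finite partition does not increase its entropy. -/
theorem partEntropy_comp_le {f : Ω → ι} (hf : Measurable f) (φ : ι → κ) :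
    partEntropy P (fun x => φ (f x)) ≤ partEntropy P f := by
  classical
  unfold partEntropy
  rw [← Finset.sum_fiberwise_of_maps_to (s := Finset.univ) (t := Finset.univ) (g := φ)
    (fun _ _ => Finset.mem_univ _)]
  refine Finset.sum_le_sum fun j _ => ?_
  have : P.real ((fun x => φ (f x)) ⁻¹' {j}) = ∑ i with φ i = j, P.real (f ⁻¹' {i}) := by
    rw [← measureReal_biUnion_finset]
    · congr 1
      ext x
      simp
    · intro i _ j _ hij
      refine Set.disjoint_left.2 fun x hx hx' => hij ?_
      exact hx.symm.trans hx'
    · exact fun i _ => hf (measurableSet_singleton i)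
  rw [this]
  exact negMulLog_sum_le fun _ => measureReal_nonneg

/-- This is `log t ≤ t - 1` at `t = a * b / p`, the pointwise form of non-negativity of mutual
information. Summed over the cells of a join, the left side vanishes. -/
theorem sub_mul_le_mul_log {p a b : ℝ} (hp : 0 ≤ p) (ha : p ≤ a) (hb : p ≤ b) :
    p - a * b ≤ p * Real.log p - p * Real.log a - p * Real.log b := by
  rcases hp.eq_or_lt with h | h
  · subst h
    simpa using mul_nonneg ha hb
  · have ha' := h.trans_le ha
    have hb' := h.trans_le hb
    have h1 := Real.log_le_sub_one_of_pos (div_pos (mul_pos ha' hb') h)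
    rw [Real.log_div (mul_pos ha' hb').ne' h.ne', Real.log_mul ha'.ne' hb'.ne'] at h1
    have h2 := mul_le_mul_of_nonneg_left h1 h.le
    have h3 : p * (a * b / p - 1) = a * b - p := by field_simp
    rw [h3] at h2
    linarith

/-- The entropy of a join is at most the sum of the entropies. -/
theorem partEntropy_prodMk_le {f : Ω → ι} {g : Ω → κ} (hf : Measurable f) (hg : Measurable g) :
    partEntropy P (fun x => (f x, g x)) ≤ partEntropy P f + partEntropy P g := by
  have hpre : ∀ i j, (fun x => (f x, g x)) ⁻¹' {(i, j)} = f ⁻¹' {i} ∩ g ⁻¹' {j} := by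
    intro i j; ext x; simp
  have hsf : ∀ i, ∑ j, P.real (f ⁻¹' {i} ∩ g ⁻¹' {j}) = P.real (f ⁻¹' {i}) := fun i => by
    rw [← sum_measureReal_fiber_inter hg (hf (measurableSet_singleton i))]
    exact Finset.sum_congr rfl fun j _ => by rw [inter_comm]
  have hsg : ∀ j, ∑ i, P.real (f ⁻¹' {i} ∩ g ⁻¹' {j}) = P.real (g ⁻¹' {j}) := fun j =>
    sum_measureReal_fiber_inter hf (hg (measurableSet_singleton j))
  have hHf : partEntropy P f = ∑ i, ∑ j,
      -(P.real (f ⁻¹' {i} ∩ g ⁻¹' {j}) * Real.log (P.real (f ⁻¹' {i}))) := by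
    refine Finset.sum_congr rfl fun i _ => ?_
    rw [Finset.sum_neg_distrib, ← Finset.sum_mul, hsf, Real.negMulLog, neg_mul]
  have hHg : partEntropy P g = ∑ i, ∑ j,
      -(P.real (f ⁻¹' {i} ∩ g ⁻¹' {j}) * Real.log (P.real (g ⁻¹' {j}))) := by
    rw [Finset.sum_comm]
    refine Finset.sum_congr rfl fun j _ => ?_
    rw [Finset.sum_neg_distrib, ← Finset.sum_mul, hsg, Real.negMulLog, neg_mul]
  have hone : ∑ i, ∑ j, (P.real (f ⁻¹' {i} ∩ g ⁻¹' {j})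
      - P.real (f ⁻¹' {i}) * P.real (g ⁻¹' {j})) = 0 := by
    simp only [Finset.sum_sub_distrib, hsf, ← Finset.mul_sum, sum_measureReal_fiber hg, mul_one,
      sub_self, Finset.sum_const_zero]
  have hkey := hone.symm.le.trans <| Finset.sum_le_sum fun i (_ : i ∈ Finset.univ) =>
    Finset.sum_le_sum fun j (_ : j ∈ Finset.univ) =>
      sub_mul_le_mul_log (p := P.real (f ⁻¹' {i} ∩ g ⁻¹' {j})) measureReal_nonneg
        (measureReal_mono inter_subset_left) (measureReal_mono inter_subset_right)
  rw [hHf, hHg, partEntropy, Fintype.sum_prod_type, ← sub_nonneg, ← Finset.sum_add_distrib,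
    ← Finset.sum_sub_distrib]
  refine hkey.trans_eq (Finset.sum_congr rfl fun i _ => ?_)
  rw [← Finset.sum_add_distrib, ← Finset.sum_sub_distrib]
  refine Finset.sum_congr rfl fun j _ => ?_
  rw [hpre, Real.negMulLog]
  ring

/-- The entropy of a join of independent partitions is the sum of the entropies. -/
theorem partEntropy_prodMk_of_indepFun {f : Ω → ι} {g : Ω → κ} (hf : Measurable f)
    (hg : Measurable g) (h : IndepFun f g P) :
    partEntropy P (fun x => (f x, g x)) = partEntropy P f + partEntropy P g := by
  have hpre : ∀ i j, P.real ((fun x => (f x, g x)) ⁻¹' {(i, j)}) =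
      P.real (f ⁻¹' {i}) * P.real (g ⁻¹' {j}) := by
    intro i j
    have : (fun x => (f x, g x)) ⁻¹' {(i, j)} = f ⁻¹' {i} ∩ g ⁻¹' {j} := by ext x; simp
    rw [this, measureReal_def, h.measure_inter_preimage_eq_mul _ _ (measurableSet_singleton i)
      (measurableSet_singleton j), ENNReal.toReal_mul, measureReal_def, measureReal_def]
  rw [partEntropy, Fintype.sum_prod_type]
  simp only [hpre, Real.negMulLog_mul, Finset.sum_add_distrib, ← Finset.mul_sum, ← Finset.sum_mul,
    sum_measureReal_fiber hg, sum_measureReal_fiber hf, one_mul]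
  rfl

theorem partEntropy_const (i : ι) : partEntropy P (fun _ : Ω => i) = 0 := by
  classical
  refine Finset.sum_eq_zero fun j _ => ?_
  by_cases h : i = j <;> simp [h]

theorem partEntropy_congr {f g : Ω → ι} (h : f =ᵐ[P] g) :
    partEntropy P f = partEntropy P g := by
  refine Finset.sum_congr rfl fun i _ => congrArg Real.negMulLog (measureReal_congr ?_)
  filter_upwards [h] with x hx
  exact congrArg (· ∈ ({i} : Set ι)) hx

theorem partEntropy_comp_measurePreserving {Ω' : Type*} [MeasurableSpace Ω'] {P' : Measure Ω'}
    {φ : Ω' → Ω} (hφ : MeasurePreserving φ P' P) {f : Ω → ι} (hf : Measurable f) :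
    partEntropy P' (fun x => f (φ x)) = partEntropy P f := by
  refine Finset.sum_congr rfl fun i _ => congrArg Real.negMulLog ?_
  exact hφ.measureReal_preimage (hf (measurableSet_singleton i)).nullMeasurableSet

/-- The entropy of a partition into two cells. -/
theorem partEntropy_fin_two {f : Ω → Fin 2} (hf : Measurable f) :
    partEntropy P f = Real.binEntropy (P.real (f ⁻¹' {1})) := by
  have h := sum_measureReal_fiber (P := P) hf
  rw [Fin.sum_univ_two] at h
  rw [partEntropy, Fin.sum_univ_two, Real.binEntropy_eq_negMulLog_add_negMulLog_one_sub,
    ← eq_sub_of_add_eq h, add_comm]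

/-- The entropy of the join of the partitions given by `F p`, `p ∈ s`. -/
noncomputable def famEntropy (P : Measure Ω) (F : α → Ω → ι) (s : Finset α) : ℝ := by
  classical
  exact partEntropy P (fun x (p : s) => F p x)

theorem famEntropy_eq [DecidableEq α] (F : α → Ω → ι) (s : Finset α) :
    famEntropy P F s = partEntropy P (fun x (p : s) => F p x) := by
  unfold famEntropy
  congr!

variable {F : α → Ω → ι} {G : α → Ω → κ} {D : α → Ω → τ}

theorem measurable_fam (hF : ∀ p, Measurable (F p)) (s : Finset α) :
    Measurable (fun x (p : s) => F p x) :=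
  measurable_pi_lambda _ fun p => hF p

theorem famEntropy_mono (hF : ∀ p, Measurable (F p)) {s t : Finset α} (h : s ⊆ t) :
    famEntropy P F s ≤ famEntropy P F t := by
  classical
  simp only [famEntropy_eq]
  exact partEntropy_comp_le (measurable_fam hF t)
    (fun (c : t → ι) (p : s) => c ⟨p, h p.2⟩)

theorem famEntropy_union_le [DecidableEq α] (hF : ∀ p, Measurable (F p)) (s t : Finset α) :
    famEntropy P F (s ∪ t) ≤ famEntropy P F s + famEntropy P F t := by
  simp only [famEntropy_eq]
  refine le_trans (le_of_eq_of_le ?_ (partEntropy_comp_le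
    ((measurable_fam hF s).prodMk (measurable_fam hF t))
    (fun (c : (s → ι) × (t → ι)) (p : (s ∪ t : Finset α)) =>
      if h : (p : α) ∈ s then c.1 ⟨p, h⟩ else
        c.2 ⟨p, (Finset.mem_union.1 p.2).resolve_left h⟩)))
    (partEntropy_prodMk_le (measurable_fam hF s) (measurable_fam hF t))
  congr 1
  funext x p
  by_cases h : (p : α) ∈ s <;> simp [h]

theorem famEntropy_empty : famEntropy P F ∅ = 0 := by
  classical
  rw [famEntropy_eq]
  have : (fun x (p : (∅ : Finset α)) => F p x) = fun _ => isEmptyElim := by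
    funext x p
    exact isEmptyElim p
  rw [this]
  exact partEntropy_const _

theorem famEntropy_singleton_le (hF : ∀ p, Measurable (F p)) (a : α) :
    famEntropy P F {a} ≤ partEntropy P (F a) := by
  classical
  rw [famEntropy_eq]
  refine le_of_eq_of_le ?_ (partEntropy_comp_le (hF a) (fun i (_ : ({a} : Finset α)) => i))
  congr 1
  funext x p
  rw [Finset.mem_singleton.1 p.2]

theorem famEntropy_le_sum (hF : ∀ p, Measurable (F p)) (s : Finset α) :
    famEntropy P F s ≤ ∑ p ∈ s, partEntropy P (F p) := by
  classical
  induction s using Finset.induction_on with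
  | empty => simp [famEntropy_empty]
  | insert a s ha ih =>
    rw [Finset.sum_insert ha, Finset.insert_eq]
    exact (famEntropy_union_le hF _ _).trans (add_le_add (famEntropy_singleton_le hF a) ih)

/-- The induction step for bounding from below the entropy of a join of independent partitions. -/
theorem add_famEntropy_le_famEntropy_insert [DecidableEq α] (hF : ∀ p, Measurable (F p)) {a : α}
    {s : Finset α} (h : IndepFun (F a) (fun x (p : s) => F p x) P) :
    partEntropy P (F a) + famEntropy P F s ≤ famEntropy P F (insert a s) := by
  simp only [famEntropy_eq]
  rw [← partEntropy_prodMk_of_indepFun (hF a) (measurable_fam hF s) h]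
  exact partEntropy_comp_le (measurable_fam hF (insert a s))
    (fun (c : ↥(insert a s) → ι) =>
      (c ⟨a, Finset.mem_insert_self a s⟩,
        fun p : s => c ⟨p, Finset.mem_insert_of_mem p.2⟩))

/-- If each `F p` is a function of `G p` and `D p`, then the join of the `F p` has at most the
entropy of the join of the `G p` plus the sum of the entropies of the `D p`. -/
theorem famEntropy_le_add_sum (hG : ∀ p, Measurable (G p)) (hD : ∀ p, Measurable (D p))
    (c : κ → τ → ι) (hc : ∀ p x, F p x = c (G p x) (D p x)) (s : Finset α) :
    famEntropy P F s ≤ famEntropy P G s + ∑ p ∈ s, partEntropy P (D p) := by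
  classical
  refine le_trans ?_ (add_le_add le_rfl (famEntropy_le_sum hD s))
  simp only [famEntropy_eq]
  refine le_trans (le_of_eq_of_le ?_ (partEntropy_comp_le
    ((measurable_fam hG s).prodMk (measurable_fam hD s))
    (fun (b : (s → κ) × (s → τ)) (p : s) => c (b.1 p) (b.2 p))))
    (partEntropy_prodMk_le (measurable_fam hG s) (measurable_fam hD s))
  simp only [hc]

end Entropy

/-! ### Almost everywhere isomorphisms and their realization by permutations -/

section AEIso

/-- The measurable maps `f` and `g` are measure preserving and inverse to each other almost
everywhere. -/
structure AEIso {Ω Ω' : Type*} [MeasurableSpace Ω] [MeasurableSpace Ω'] (P : Measure Ω)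
    (P' : Measure Ω') (f : Ω → Ω') (g : Ω' → Ω) : Prop where
  mp : MeasurePreserving f P P'
  mp_inv : MeasurePreserving g P' P
  left_inv : ∀ᵐ x ∂P, g (f x) = x
  right_inv : ∀ᵐ y ∂P', f (g y) = y

variable {Ω Ω' Ω'' : Type*} [MeasurableSpace Ω] [MeasurableSpace Ω'] [MeasurableSpace Ω'']
  {P : Measure Ω} {P' : Measure Ω'} {P'' : Measure Ω''}

theorem AEIso.symm {f : Ω → Ω'} {g : Ω' → Ω} (h : AEIso P P' f g) : AEIso P' P g f :=
  ⟨h.mp_inv, h.mp, h.right_inv, h.left_inv⟩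

theorem AEIso.trans {f : Ω → Ω'} {g : Ω' → Ω} {f' : Ω' → Ω''} {g' : Ω'' → Ω'}
    (h : AEIso P P' f g) (h' : AEIso P' P'' f' g') :
    AEIso P P'' (fun x => f' (f x)) (fun x => g (g' x)) := by
  refine ⟨h'.mp.comp h.mp, h.mp_inv.comp h'.mp_inv, ?_, ?_⟩
  · filter_upwards [h.mp.quasiMeasurePreserving.ae h'.left_inv, h.left_inv] with x h1 h2
    rw [h1, h2]
  · filter_upwards [h'.mp_inv.quasiMeasurePreserving.ae h.right_inv, h'.right_inv] with x h1 h2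
    rw [h1, h2]

/-- A measure-preserving map with a measurable almost everywhere left inverse is an isomorphism. -/
theorem AEIso.of_left_inv [StandardBorelSpace Ω'] {f : Ω → Ω'} {g : Ω' → Ω}
    (hf : MeasurePreserving f P P') (hg : Measurable g)
    (h : ∀ᵐ x ∂P, g (f x) = x) : AEIso P P' f g := by
  have h1 : Measure.map g P' = P := by
    rw [← hf.map_eq, Measure.map_map hg hf.measurable]
    exact (Measure.map_congr h).trans Measure.map_id
  refine ⟨hf, ⟨hg, h1⟩, h, ?_⟩
  rw [← hf.map_eq]
  refine (ae_map_iff hf.measurable.aemeasurable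
    (measurableSet_eq_fun (hf.measurable.comp hg) measurable_id)).2 ?_
  filter_upwards [h] with x hx
  exact congrArg f hx

theorem not_countable_of_nullSingletonClass (P : Measure Ω) [IsProbabilityMeasure P]
    [NullSingletonClass P] : ¬ Countable Ω := by
  intro h
  have h1 : P univ = 0 := Set.countable_univ.measure_zero P
  simp at h1

/-- An atomless probability on a standard Borel space has an uncountable null set. -/
theorem exists_not_countable_null [StandardBorelSpace Ω] (P : Measure Ω) [IsProbabilityMeasure P]
    [NullSingletonClass P] : ∃ N : Set Ω, MeasurableSet N ∧ P N = 0 ∧ ¬ N.Countable := by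
  have hΩ := not_countable_of_nullSingletonClass P
  have hR : ¬ Countable ℝ := not_countable
  let e : Ω ≃ᵐ ℝ := PolishSpace.measurableEquivOfNotCountable hΩ hR
  let Q : Measure ℝ := P.map e
  have : IsProbabilityMeasure Q := Measure.isProbabilityMeasure_map e.measurable.aemeasurable
  -- The rationals are null for an atomless `Q`, so open sets of small measure contain them. The
  -- intersection of these is a null dense `Gδ`, uncountable by Baire's theorem.
  have hQ : Q (range ((↑) : ℚ → ℝ)) = 0 := by
    rw [e.map_apply]
    exact ((countable_range _).preimage e.injective).measure_zero P
  have hU : ∀ n : ℕ, ∃ U ⊇ range ((↑) : ℚ → ℝ), IsOpen U ∧ Q U < ((n : ENNReal) + 1)⁻¹ :=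
    fun n => Set.exists_isOpen_lt_of_lt _ _ (by rw [hQ]; simp)
  choose U hUQ hUo hU using hU
  have hG0 : Q (⋂ n, U n) = 0 := by
    refine le_antisymm (ENNReal.le_of_forall_pos_le_add fun ε hε _ => ?_) zero_le
    obtain ⟨n, hn⟩ := ENNReal.exists_inv_nat_lt (a := (ε : ENNReal)) (by exact_mod_cast hε.ne')
    rw [zero_add]
    refine (measure_mono (iInter_subset _ n)).trans ((hU n).le.trans (le_trans ?_ hn.le))
    exact ENNReal.inv_le_inv.2 le_self_add
  have hGd : IsGδ (⋂ n, U n) := IsGδ.iInter_of_isOpen hUo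
  have hdense : Dense (⋂ n, U n) :=
    (Rat.denseRange_cast (𝕜 := ℝ)).mono (subset_iInter hUQ)
  refine ⟨e ⁻¹' ⋂ n, U n, e.measurable hGd.measurableSet, by rwa [← e.map_apply], fun hc => ?_⟩
  have hc' : (⋂ n, U n).Countable := by
    rw [← e.surjective.image_preimage (⋂ n, U n)]
    exact hc.image _
  obtain ⟨x, hx, hx'⟩ := (hdense.inter_of_Gδ hGd hc'.isGδ_compl (hc'.dense_compl ℝ)).nonempty
  exact hx' hx

/-- An almost everywhere isomorphism of an atomless standard probability space coincides almost
everywhere with an everywhere invertible transformation. -/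
theorem AEIso.exists_mpGroup [StandardBorelSpace Ω] [IsProbabilityMeasure P]
    [NullSingletonClass P] {f g : Ω → Ω} (h : AEIso P P f g) :
    ∃ S : mpGroup P, ∀ᵐ x ∂P, (S : Equiv.Perm Ω) x = f x := by
  classical
  obtain ⟨N, hN, hN0, hNc⟩ := exists_not_countable_null P
  have hf := h.mp.measurable
  have hg := h.mp_inv.measurable
  -- Discarding `N` and its preimage makes both `sᶜ` and `tᶜ` contain the uncountable set `N`, so
  -- these null remainders are Borel isomorphic and the bijection `s ≃ t` extends to all of `Ω`.
  let s : Set Ω := {x | g (f x) = x} ∩ (Nᶜ ∩ f ⁻¹' Nᶜ)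
  let t : Set Ω := {y | f (g y) = y} ∩ (Nᶜ ∩ g ⁻¹' Nᶜ)
  have hs : MeasurableSet s :=
    (measurableSet_eq_fun (hg.comp hf) measurable_id).inter (hN.compl.inter (hf hN.compl))
  have ht : MeasurableSet t :=
    (measurableSet_eq_fun (hf.comp hg) measurable_id).inter (hN.compl.inter (hg hN.compl))
  have hfs : ∀ x ∈ s, f x ∈ t := by
    rintro x ⟨h1, h2, h3⟩
    refine ⟨congrArg f h1, h3, ?_⟩
    change g (f x) ∈ Nᶜ
    rwa [h1]
  have hgt : ∀ y ∈ t, g y ∈ s := by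
    rintro y ⟨h1, h2, h3⟩
    refine ⟨congrArg g h1, h3, ?_⟩
    change f (g y) ∈ Nᶜ
    rwa [h1]
  have hsae : ∀ᵐ x ∂P, x ∈ s := by
    have h0 : ∀ᵐ x ∂P, x ∈ Nᶜ := measure_eq_zero_iff_ae_notMem.1 hN0
    filter_upwards [h.left_inv, h0, h.mp.quasiMeasurePreserving.ae h0] with x h1 h2 h3
    exact ⟨h1, h2, h3⟩
  let a : s ≃ᵐ t :=
    { toFun := fun x => ⟨f x, hfs x x.2⟩
      invFun := fun y => ⟨g y, hgt y y.2⟩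
      left_inv := fun x => Subtype.ext x.2.1
      right_inv := fun y => Subtype.ext y.2.1
      measurable_toFun := (hf.comp measurable_subtype_coe).subtype_mk
      measurable_invFun := (hg.comp measurable_subtype_coe).subtype_mk }
  have hsc : ¬ Countable (sᶜ : Set Ω) := fun hc =>
    hNc ((Set.countable_coe_iff.1 hc).mono (subset_compl_comm.1 fun x hx => hx.2.1))
  have htc : ¬ Countable (tᶜ : Set Ω) := fun hc =>
    hNc ((Set.countable_coe_iff.1 hc).mono (subset_compl_comm.1 fun x hx => hx.2.1))
  have : StandardBorelSpace (sᶜ : Set Ω) := hs.compl.standardBorel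
  have : StandardBorelSpace (tᶜ : Set Ω) := ht.compl.standardBorel
  let b : (sᶜ : Set Ω) ≃ᵐ (tᶜ : Set Ω) := PolishSpace.measurableEquivOfNotCountable hsc htc
  let e : Ω ≃ᵐ Ω := (MeasurableEquiv.sumCompl hs).symm.trans
    ((MeasurableEquiv.sumCongr a b).trans (MeasurableEquiv.sumCompl ht))
  have he : ∀ x ∈ s, e x = f x := by
    intro x hx
    have : (MeasurableEquiv.sumCompl hs).symm x = Sum.inl ⟨x, hx⟩ := by
      rw [MeasurableEquiv.symm_apply_eq]
      rfl
    change MeasurableEquiv.sumCompl ht (MeasurableEquiv.sumCongr a b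
      ((MeasurableEquiv.sumCompl hs).symm x)) = _
    rw [this]
    rfl
  have hae : ∀ᵐ x ∂P, e x = f x := by
    filter_upwards [hsae] with x hx using he x hx
  have hmp : MeasurePreserving e P P :=
    ⟨e.measurable, (Measure.map_congr hae).trans h.mp.map_eq⟩
  exact ⟨⟨e.toEquiv, hmp, hmp.symm e⟩, hae⟩

end AEIso

/-! ### Isomorphism theorem for atomless standard spaces, respecting a partition -/

section Isomorphism

theorem continuous_cdf (P : Measure ℝ) [IsProbabilityMeasure P] [NullSingletonClass P] :
    Continuous (cdf P) := by
  rw [continuous_iff_continuousAt]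
  intro x
  rw [(cdf P).mono.continuousAt_iff_leftLim_eq_rightLim, (cdf P).rightLim_eq]
  refine le_antisymm ((cdf P).mono.leftLim_le le_rfl) ?_
  have h := (cdf P).measure_singleton x
  rw [measure_cdf, measure_singleton, eq_comm, ENNReal.ofReal_eq_zero] at h
  linarith

open Classical in
/-- The quantile function of a probability on the line, extended by `0` outside `(0, 1)`. -/
noncomputable def quantile (P : Measure ℝ) (t : ℝ) : ℝ :=
  if t ∈ Ioo (0 : ℝ) 1 then sInf {x | t ≤ cdf P x} else 0

/-- Without atoms the superlevel set of the cdf is closed, and `0 < t < 1` makes it nonempty and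
bounded below, so its infimum is attained. -/
theorem quantile_le_iff (P : Measure ℝ) [IsProbabilityMeasure P] [NullSingletonClass P] {t : ℝ}
    (ht : t ∈ Ioo (0 : ℝ) 1) (x : ℝ) : quantile P t ≤ x ↔ t ≤ cdf P x := by
  have hcl : IsClosed {x | t ≤ cdf P x} := isClosed_le continuous_const (continuous_cdf P)
  have hne : {x | t ≤ cdf P x}.Nonempty :=
    ((tendsto_cdf_atTop P).eventually_const_le ht.2).exists
  have hbd : BddBelow {x | t ≤ cdf P x} := by
    obtain ⟨a, ha⟩ := ((tendsto_cdf_atBot P).eventually_lt_const ht.1).exists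
    refine ⟨a, fun x hx => le_of_not_gt fun hxa => ?_⟩
    exact absurd (hx.trans (monotone_cdf P hxa.le)) (not_le.2 ha)
  rw [quantile, if_pos ht]
  refine ⟨fun h => ?_, fun h => csInf_le hbd h⟩
  exact (hcl.csInf_mem hne hbd : t ≤ _).trans (monotone_cdf P h)

theorem cdf_quantile (P : Measure ℝ) [IsProbabilityMeasure P] [NullSingletonClass P] {t : ℝ}
    (ht : t ∈ Ioo (0 : ℝ) 1) : cdf P (quantile P t) = t := by
  refine le_antisymm ?_ ((quantile_le_iff P ht _).1 le_rfl)
  obtain ⟨x, hx⟩ : t ∈ range (cdf P) := mem_range_of_exists_le_of_exists_ge (continuous_cdf P)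
    ((tendsto_cdf_atBot P).eventually_le_const ht.1).exists
    ((tendsto_cdf_atTop P).eventually_const_le ht.2).exists
  exact (monotone_cdf P ((quantile_le_iff P ht x).2 hx.ge)).trans hx.le

theorem measurable_quantile (P : Measure ℝ) [IsProbabilityMeasure P] [NullSingletonClass P] :
    Measurable (quantile P) := by
  classical
  refine measurable_of_Iic fun x => ?_
  have : quantile P ⁻¹' Iic x =
      (Ioo 0 1 ∩ Iic (cdf P x)) ∪ ((Ioo (0 : ℝ) 1)ᶜ ∩ {_t | 0 ≤ x}) := by
    ext t
    by_cases ht : t ∈ Ioo (0 : ℝ) 1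
    · simp only [mem_preimage, mem_Iic, quantile_le_iff P ht, mem_union, mem_inter_iff, ht,
        mem_compl_iff, not_true, true_and, false_and, or_false]
    · simp only [mem_preimage, mem_Iic, quantile, if_false, mem_union, mem_inter_iff, ht,
        mem_compl_iff, not_false_eq_true, true_and, false_and, false_or, mem_ofPred_eq]
  rw [this]
  exact (measurableSet_Ioo.inter measurableSet_Iic).union
    (measurableSet_Ioo.compl.inter (MeasurableSet.const _))

/-- The quantile function pushes Lebesgue measure to `P`, and continuity of the cdf makes the cdf a
left inverse of it. -/
theorem aeIso_quantile_cdf (P : Measure ℝ) [IsProbabilityMeasure P] [NullSingletonClass P] :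
    AEIso (volume.restrict (Ioo (0 : ℝ) 1)) P (quantile P) (cdf P) := by
  refine AEIso.of_left_inv ⟨measurable_quantile P, ?_⟩ (continuous_cdf P).measurable ?_
  · refine (Measure.ext_of_Iic _ _ fun x => ?_).symm
    rw [Measure.map_apply (measurable_quantile P) measurableSet_Iic,
      Measure.restrict_apply (measurable_quantile P measurableSet_Iic)]
    have : quantile P ⁻¹' Iic x ∩ Ioo 0 1 = Ioo 0 1 ∩ Iic (cdf P x) := by
      ext t
      simp only [mem_inter_iff, mem_preimage, mem_Iic, and_comm (a := quantile P t ≤ x)]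
      exact and_congr_right fun ht => quantile_le_iff P ht x
    have h2 : (Ioo (0 : ℝ) 1 ∩ Iic (cdf P x) : Set ℝ) =ᵐ[volume] Ioc 0 (cdf P x) := by
      have h3 : ∀ᵐ t : ℝ, t ≠ 1 := Measure.ae_ne volume 1
      filter_upwards [h3] with t ht
      refine propext ⟨fun h => ⟨h.1.1, h.2⟩, fun h => ⟨⟨h.1, ?_⟩, h.2⟩⟩
      exact lt_of_le_of_ne (h.2.trans (cdf_le_one P x)) ht
    rw [this, measure_congr h2, Real.volume_Ioc, sub_zero, ofReal_cdf]
  · exact (ae_restrict_iff' measurableSet_Ioo).2 (Eventually.of_forall fun t ht => cdf_quantile P ht)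

variable {Ω Ω' : Type*} [MeasurableSpace Ω] [StandardBorelSpace Ω] [MeasurableSpace Ω']
  [StandardBorelSpace Ω'] {P : Measure Ω} {P' : Measure Ω'} [IsProbabilityMeasure P]
  [IsProbabilityMeasure P'] [NullSingletonClass P] [NullSingletonClass P']

/-- An atomless standard probability space is isomorphic to the unit interval, in such a way that
the cells of a given partition become consecutive intervals. -/
theorem exists_aeIso_unit {q : Ω → ℕ} (hq : Measurable q) :
    ∃ (g : ℝ → Ω) (f : Ω → ℝ), AEIso (volume.restrict (Ioo (0 : ℝ) 1)) P g f ∧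
      ∀ᵐ t ∂(volume.restrict (Ioo (0 : ℝ) 1)), ∀ i : ℕ, q (g t) < i ↔ t ≤ P.real {x | q x < i} := by
  have : Nonempty Ω := by
    by_contra h
    rw [not_nonempty_iff] at h
    exact not_countable_of_nullSingletonClass P inferInstance
  let u : Ω → ℝ := fun x => Real.sigmoid (embeddingReal Ω x)
  have hu0 : ∀ x, 0 < u x := fun x => Real.sigmoid_pos _
  have hu1 : ∀ x, u x < 1 := fun x => Real.sigmoid_lt_one _
  have hum : Measurable u :=
    continuous_sigmoid.measurable.comp (measurableEmbedding_embeddingReal Ω).measurable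
  have hui : Function.Injective u :=
    Real.sigmoid_injective.comp (measurableEmbedding_embeddingReal Ω).injective
  -- Placing the cell with label `i` inside `(i, i + 1)` gives an injection into the line for which
  -- the label condition `q x < i` is an order condition. The quantile function then turns cells
  -- into consecutive intervals.
  let θ : Ω → ℝ := fun x => q x + u x
  have hθm : Measurable θ := (measurable_from_top.comp hq).add hum
  have hθq : ∀ x (i : ℕ), q x < i ↔ θ x ≤ i := by
    intro x i
    constructor
    · intro h
      have : ((q x + 1 : ℕ) : ℝ) ≤ i := by exact_mod_cast h
      push_cast at this
      change (q x : ℝ) + u x ≤ i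
      linarith [hu1 x]
    · intro h
      have : (q x : ℝ) < i := by
        change (q x : ℝ) + u x ≤ i at h
        linarith [hu0 x]
      exact_mod_cast this
  have hθi : Function.Injective θ := by
    intro x y hxy
    have h1 : q x = q y := by
      refine le_antisymm ?_ ?_
      · rw [← Nat.lt_succ_iff, hθq, hxy, ← hθq]; exact Nat.lt_succ_self _
      · rw [← Nat.lt_succ_iff, hθq, ← hxy, ← hθq]; exact Nat.lt_succ_self _
    have h2 : (q x : ℝ) + u x = q y + u y := hxy
    rw [h1] at h2
    exact hui (add_left_cancel h2)
  have hθ : MeasurableEmbedding θ := hθm.measurableEmbedding hθi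
  let Q : Measure ℝ := P.map θ
  have hθmp : MeasurePreserving θ P Q := ⟨hθm, rfl⟩
  have : IsProbabilityMeasure Q := Measure.isProbabilityMeasure_map hθm.aemeasurable
  have : NullSingletonClass Q := ⟨fun a => by
    rw [hθ.map_apply]
    exact ((countable_singleton a).preimage hθi).measure_zero P⟩
  have hiso : AEIso P Q θ hθ.invFun := AEIso.of_left_inv hθmp hθ.measurable_invFun
    (Eventually.of_forall hθ.leftInverse_invFun)
  have hquant := aeIso_quantile_cdf Q
  refine ⟨_, _, hquant.trans hiso.symm, ?_⟩
  filter_upwards [hquant.mp.quasiMeasurePreserving.ae hiso.right_inv,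
    ae_restrict_mem measurableSet_Ioo] with t h1 h2 i
  have h3 : Q.real (Iic (i : ℝ)) = P.real {x | q x < i} := by
    rw [← hθmp.measureReal_preimage measurableSet_Iic.nullMeasurableSet]
    exact congrArg P.real (Set.ext fun x => (hθq x i).symm)
  rw [hθq, h1, quantile_le_iff Q h2, cdf_eq_real, h3]

/-- Two atomless standard probability spaces are isomorphic, in such a way that given partitions
with the same distribution correspond to each other. -/
theorem exists_aeIso_of_map_eq {q : Ω → ℕ} {q' : Ω' → ℕ} (hq : Measurable q) (hq' : Measurable q')
    (h : ∀ s : Set ℕ, P (q ⁻¹' s) = P' (q' ⁻¹' s)) :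
    ∃ (f : Ω → Ω') (g : Ω' → Ω), AEIso P P' f g ∧ ∀ᵐ x ∂P, q' (f x) = q x := by
  obtain ⟨g₁, f₁, h₁, hg₁⟩ := exists_aeIso_unit (P := P) hq
  obtain ⟨g₂, f₂, h₂, hg₂⟩ := exists_aeIso_unit (P := P') hq'
  refine ⟨_, _, h₁.symm.trans h₂, ?_⟩
  have h3 := h₁.mp_inv.quasiMeasurePreserving.ae (hg₁.and hg₂)
  filter_upwards [h3, h₁.right_inv] with x hx hx2
  obtain ⟨ha, hb⟩ := hx
  rw [hx2] at ha
  have h4 : ∀ i : ℕ, q' (g₂ (f₁ x)) < i ↔ q x < i := fun i => by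
    rw [ha, hb, measureReal_def, measureReal_def]
    have := h (Iio i)
    exact Iff.of_eq (congrArg (fun z : ENNReal => f₁ x ≤ z.toReal) this.symm)
  refine le_antisymm ?_ ?_
  · rw [← Nat.lt_succ_iff, h4]; exact Nat.lt_succ_self _
  · rw [← Nat.lt_succ_iff, ← h4]; exact Nat.lt_succ_self _

end Isomorphism

/-! ### Completeness of the measure algebra and limits of measure-preserving maps -/

section MeasuredSets

variable {X : Type*} [MeasurableSpace X] {μ : Measure X}

theorem measurableSet_coe (s : MeasuredSets μ) : MeasurableSet (s : Set X) := s.2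

/-- A measurable set as a point of the space of measurable sets. -/
def measuredSet (μ : Measure X) (B : Set X) (hB : MeasurableSet B) : MeasuredSets μ := ⟨B, hB⟩

/-- The space of measurable sets with the distance `μ (s ∆ t)` is complete. -/
theorem completeSpace_measuredSets (μ : Measure X) : CompleteSpace (MeasuredSets μ) := by
  refine EMetric.complete_of_convergent_controlled_sequences (fun n : ℕ => (2⁻¹ : ENNReal) ^ n)
    (fun n => ENNReal.pow_pos (by simp) n) fun u hu => ?_
  -- The limit is the set-theoretic liminf. A point of `u n ∆ G` must change membership at some
  -- later index, and these changes have summable measure.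
  let G : MeasuredSets μ := ⟨{x | ∃ N, ∀ n, N ≤ n → x ∈ (u n : Set X)}, by
    have : {x | ∃ N, ∀ n, N ≤ n → x ∈ (u n : Set X)} =
        ⋃ N : ℕ, ⋂ n : ℕ, ⋂ _ : N ≤ n, (u n : Set X) := by
      ext x; simp
    rw [this]
    exact MeasurableSet.iUnion fun N => MeasurableSet.iInter fun n => MeasurableSet.iInter
      fun _ => (measurableSet_coe (u n))⟩
  refine ⟨G, tendsto_iff_edist_tendsto_0.2 ?_⟩
  have hsub : ∀ n, ((u n : Set X) ∆ (G : Set X)) ⊆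
      ⋃ k : ℕ, ((u (n + k) : Set X) ∆ (u (n + k + 1) : Set X)) := by
    intro n x hx
    by_contra hcon
    have h1 : ∀ k, (x ∈ (u (n + k) : Set X) ↔ x ∈ (u (n + k + 1) : Set X)) := by
      intro k
      have : x ∉ (u (n + k) : Set X) ∆ (u (n + k + 1) : Set X) := fun h =>
        hcon (mem_iUnion.2 ⟨k, h⟩)
      rw [mem_symmDiff] at this
      tauto
    have h2 : ∀ k, (x ∈ (u n : Set X) ↔ x ∈ (u (n + k) : Set X)) := by
      intro k
      induction k with
      | zero => rfl
      | succ k ih => exact ih.trans (h1 k)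
    have h3 : x ∈ (u n : Set X) ↔ x ∈ (G : Set X) := by
      constructor
      · intro h
        refine ⟨n, fun m hm => ?_⟩
        obtain ⟨k, rfl⟩ := Nat.exists_eq_add_of_le hm
        exact (h2 k).1 h
      · rintro ⟨N, hN⟩
        exact (h2 N).2 (hN _ (Nat.le_add_left _ _))
    rw [mem_symmDiff] at hx
    tauto
  have hbound : ∀ n, edist (u n) G ≤ (2⁻¹ : ENNReal) ^ n * 2 := by
    intro n
    refine (measure_mono (hsub n)).trans ((measure_iUnion_le _).trans ?_)
    calc ∑' k, μ ((u (n + k) : Set X) ∆ (u (n + k + 1) : Set X))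
        ≤ ∑' k : ℕ, (2⁻¹ : ENNReal) ^ n * 2⁻¹ ^ k := by
          refine ENNReal.tsum_le_tsum fun k => ?_
          rw [← pow_add]
          exact (hu (n + k) (n + k) (n + k + 1) le_rfl (Nat.le_succ _)).le
      _ = (2⁻¹ : ENNReal) ^ n * 2 := by
          rw [ENNReal.tsum_mul_left, ENNReal.tsum_geometric, ENNReal.one_sub_inv_two, inv_inv]
  have hlim : Tendsto (fun n : ℕ => (2⁻¹ : ENNReal) ^ n * 2) atTop (𝓝 (0 * 2)) :=
    ENNReal.Tendsto.mul_const
      (ENNReal.tendsto_pow_atTop_nhds_zero_of_lt_one (by simp)) (Or.inr (by simp))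
  rw [zero_mul] at hlim
  exact tendsto_of_tendsto_of_tendsto_of_le_of_le tendsto_const_nhds hlim
    (fun _ => zero_le) hbound

variable [IsProbabilityMeasure μ]

theorem abs_measureReal_biInter_sub_le {ι : Type*} (F : Finset ι) {s t : ι → Set X}
    (hs : ∀ i, MeasurableSet (s i)) (ht : ∀ i, MeasurableSet (t i)) :
    |μ.real (⋂ i ∈ F, s i) - μ.real (⋂ i ∈ F, t i)| ≤ ∑ i ∈ F, μ.real (s i ∆ t i) := by
  refine (abs_measureReal_sub_le_measureReal_symmDiff
    (F.measurableSet_biInter fun i _ => hs i).nullMeasurableSet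
    (F.measurableSet_biInter fun i _ => ht i).nullMeasurableSet).trans ?_
  refine le_trans (measureReal_mono ?_ (measure_ne_top μ _)) (measureReal_biUnion_finset_le F _)
  intro x hx
  simp only [mem_symmDiff, mem_iInter, mem_iUnion] at hx ⊢
  by_contra hcon
  push Not at hcon
  rcases hx with ⟨h1, h2⟩ | ⟨h1, h2⟩
  · exact h2 fun i hi => (hcon i hi).1 (h1 i hi)
  · exact h2 fun i hi => (hcon i hi).2 (h1 i hi)

/-- Replacing `B` by `C` on either side costs `μ (B ∆ C)` by invariance. This carries convergence
from a dense sequence to all measurable sets. -/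
theorem measureReal_preimage_symmDiff_le {f g : X → X} (hf : MeasurePreserving f μ μ)
    (hg : MeasurePreserving g μ μ) {B C : Set X} (hB : MeasurableSet B) (hC : MeasurableSet C) :
    μ.real ((f ⁻¹' B) ∆ (g ⁻¹' B)) ≤ 2 * μ.real (B ∆ C) + μ.real ((f ⁻¹' C) ∆ (g ⁻¹' C)) := by
  have hpre : ∀ {R : X → X}, MeasurePreserving R μ μ →
      μ.real ((R ⁻¹' B) ∆ (R ⁻¹' C)) = μ.real (B ∆ C) := fun {R} hR => by
    rw [← preimage_symmDiff, hR.measureReal_preimage (hB.symmDiff hC).nullMeasurableSet]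
  have h1 := hpre hf
  have h2 := hpre hg
  rw [symmDiff_comm] at h2
  have t1 := measureReal_symmDiff_le (μ := μ) (s := f ⁻¹' B) (t := f ⁻¹' C) (g ⁻¹' B)
  have t2 := measureReal_symmDiff_le (μ := μ) (s := f ⁻¹' C) (t := g ⁻¹' C) (g ⁻¹' B)
  linarith

/-- The events that all coordinates in a finite set hold form a π-system generating the product
σ-algebra on `ℕ → Prop`. -/
theorem measure_map_mem_eq {A G : ℕ → Set X} (hA : ∀ i, MeasurableSet (A i))
    (hG : ∀ i, MeasurableSet (G i))
    (h : ∀ F : Finset ℕ, μ (⋂ i ∈ F, G i) = μ (⋂ i ∈ F, A i)) :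
    μ.map (fun x i => x ∈ G i) = μ.map (fun x i => x ∈ A i) := by
  have hmeas : ∀ {D : ℕ → Set X}, (∀ i, MeasurableSet (D i)) →
      Measurable (fun x i => x ∈ D i) := fun hD =>
    measurable_pi_lambda _ fun i => measurableSet_setOfPred.1 (hD i)
  have := Measure.isProbabilityMeasure_map (μ := μ) (hmeas hA).aemeasurable
  have := Measure.isProbabilityMeasure_map (μ := μ) (hmeas hG).aemeasurable
  have hcyl : ∀ F : Finset ℕ, MeasurableSet {c : ℕ → Prop | ∀ i ∈ F, c i} := fun F =>
    measurableSet_setOfPred.2 (by fun_prop)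
  refine ext_of_generate_finite (Set.range fun F : Finset ℕ => {c : ℕ → Prop | ∀ i ∈ F, c i})
    ?_ ?_ ?_ (by simp)
  · refine le_antisymm ?_ (MeasurableSpace.generateFrom_le ?_)
    · have : @Measurable _ _ (MeasurableSpace.generateFrom
          (Set.range fun F : Finset ℕ => {c : ℕ → Prop | ∀ i ∈ F, c i})) MeasurableSpace.pi
          (fun c : ℕ → Prop => c) := by
        refine @measurable_pi_lambda _ _ _ (_) _ _ fun i => @measurable_to_prop _ (_) _ ?_
        refine MeasurableSpace.measurableSet_generateFrom ⟨{i}, ?_⟩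
        ext c
        simp
      exact fun s hs => this hs
    · rintro _ ⟨F, rfl⟩
      exact hcyl F
  · rintro _ ⟨F, rfl⟩ _ ⟨F', rfl⟩ _
    refine ⟨F ∪ F', ?_⟩
    ext c
    simp only [Finset.mem_union, mem_ofPred_eq, mem_inter_iff]
    exact ⟨fun h => ⟨fun i hi => h i (Or.inl hi), fun i hi => h i (Or.inr hi)⟩,
      fun h i hi => hi.elim (h.1 i) (h.2 i)⟩
  · rintro _ ⟨F, rfl⟩
    have hpre : ∀ D : ℕ → Set X,
        (fun x i => x ∈ D i) ⁻¹' {c : ℕ → Prop | ∀ i ∈ F, c i} = ⋂ i ∈ F, D i := by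
      intro D; ext x; simp
    rw [Measure.map_apply (hmeas hG) (hcyl F), Measure.map_apply (hmeas hA) (hcyl F), hpre, hpre, h]

variable [StandardBorelSpace X]

/-- A dense sequence of measurable sets separates points almost everywhere, measurably. -/
theorem exists_measurable_ae_leftInverse (A : ℕ → MeasuredSets μ) (hA : DenseRange A) :
    ∃ r : (ℕ → Prop) → X, Measurable r ∧ ∀ᵐ x ∂μ, r (fun i => x ∈ (A i : Set X)) = x := by
  classical
  have : Nonempty X := nonempty_of_isProbabilityMeasure μ
  have hm : MeasurableEmbedding (MeasurableSpace.mapNatBool X) :=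
    (MeasurableSpace.measurable_mapNatBool X).measurableEmbedding
      (MeasurableSpace.injective_mapNatBool X)
  let U : ℕ → Set X := MeasurableSpace.natGeneratingSequence X
  have hU : ∀ k, MeasurableSet (U k) := MeasurableSpace.measurableSet_natGeneratingSequence
  have hex : ∀ k n : ℕ, ∃ i, μ (U k ∆ (A i : Set X)) < (2⁻¹ : ENNReal) ^ n := fun k n => by
    obtain ⟨_, ⟨i, rfl⟩, hi⟩ := EMetric.mem_closure_iff.1 (hA ⟨U k, hU k⟩) ((2⁻¹ : ENNReal) ^ n)
      (ENNReal.pow_pos (by simp) n)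
    exact ⟨i, hi⟩
  choose i hi using hex
  -- The sets `A (i k n)` approach `U k` summably fast, so by Borel–Cantelli almost every point has
  -- eventually the same membership in both, and `w` reads off membership in the generating sets `U
  -- k`.
  let w : (ℕ → Prop) → (ℕ → Bool) := fun c k => decide (∃ N, ∀ n, N ≤ n → c (i k n))
  have hw : Measurable w := by
    refine measurable_pi_lambda _ fun k => measurable_to_bool ?_
    have : (fun c : ℕ → Prop => decide (∃ N, ∀ n, N ≤ n → c (i k n))) ⁻¹' {true} =
        {c | ∃ N, ∀ n, N ≤ n → c (i k n)} := by
      ext c; simp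
    rw [this]
    exact measurableSet_setOfPred.2 (by fun_prop)
  refine ⟨fun c => hm.invFun (w c), hm.measurable_invFun.comp hw, ?_⟩
  have hBC : ∀ᵐ x ∂μ, ∀ k, ∀ᶠ n in atTop, x ∉ U k ∆ (A (i k n) : Set X) := by
    refine ae_all_iff.2 fun k => ae_eventually_notMem (ne_of_lt ?_)
    refine (ENNReal.tsum_le_tsum fun n => (hi k n).le).trans_lt ?_
    rw [ENNReal.tsum_geometric, ENNReal.one_sub_inv_two, inv_inv]
    simp
  filter_upwards [hBC] with x hx
  have : w (fun i => x ∈ (A i : Set X)) = MeasurableSpace.mapNatBool X x := by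
    funext k
    obtain ⟨N, hN⟩ := eventually_atTop.1 (hx k)
    have hN' : ∀ n, N ≤ n → (x ∈ U k ↔ x ∈ (A (i k n) : Set X)) := fun n hn => by
      have := hN n hn
      rw [mem_symmDiff] at this
      tauto
    refine decide_eq_decide.2 ⟨?_, fun h => ⟨N, fun n hn => (hN' n hn).1 h⟩⟩
    rintro ⟨M, hM⟩
    exact (hN' (max N M) (le_max_left _ _)).2 (hM _ (le_max_right _ _))
  rw [this]
  exact hm.leftInverse_invFun x

/-- If measure-preserving maps converge on a dense sequence of sets, then they converge to a
measure-preserving map. -/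
theorem exists_limit_measurePreserving (A : ℕ → MeasuredSets μ) (hA : DenseRange A)
    {t : ℕ → X → X} (ht : ∀ n, MeasurePreserving (t n) μ μ)
    (hc : ∀ i, CauchySeq fun n =>
      measuredSet μ (t n ⁻¹' (A i : Set X)) ((ht n).measurable (measurableSet_coe (A i)))) :
    ∃ f : X → X, MeasurePreserving f μ μ ∧ ∀ B, MeasurableSet B →
      Tendsto (fun n => μ.real ((t n ⁻¹' B) ∆ (f ⁻¹' B))) atTop (𝓝 0) := by
  have := completeSpace_measuredSets μ
  choose G hG using fun i => cauchySeq_tendsto_of_complete (hc i)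
  have hG' : ∀ i, Tendsto (fun n => μ.real ((t n ⁻¹' (A i : Set X)) ∆ (G i : Set X))) atTop
      (𝓝 0) := fun i => tendsto_iff_dist_tendsto_zero.1 (hG i)
  obtain ⟨r, hr, hrA⟩ := exists_measurable_ae_leftInverse A hA
  -- `a x` is the address of `x` with respect to the sets `A i`, and `g x` is the limiting address
  -- of `t n x`. Decoding it gives the limit map `r ∘ g`, measure preserving because both addresses
  -- have the same law.
  let a : X → ℕ → Prop := fun x i => x ∈ (A i : Set X)
  let g : X → ℕ → Prop := fun x i => x ∈ (G i : Set X)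
  have ha : Measurable a := measurable_pi_lambda _ fun i => measurableSet_setOfPred.1 (measurableSet_coe (A i))
  have hg : Measurable g := measurable_pi_lambda _ fun i => measurableSet_setOfPred.1 (measurableSet_coe (G i))
  have hlaw : μ.map g = μ.map a := by
    refine measure_map_mem_eq (fun i => (measurableSet_coe (A i))) (fun i => (measurableSet_coe (G i))) fun F => ?_
    have h1 : ∀ n, |μ.real (⋂ j ∈ F, t n ⁻¹' (A j : Set X)) - μ.real (⋂ j ∈ F, (G j : Set X))| ≤
        ∑ j ∈ F, μ.real ((t n ⁻¹' (A j : Set X)) ∆ (G j : Set X)) := fun n =>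
      abs_measureReal_biInter_sub_le F (fun j => (ht n).measurable (measurableSet_coe (A j))) fun j => (measurableSet_coe (G j))
    have h2 : ∀ n, μ.real (⋂ j ∈ F, t n ⁻¹' (A j : Set X)) = μ.real (⋂ j ∈ F, (A j : Set X)) := by
      intro n
      rw [← (ht n).measureReal_preimage
        (F.measurableSet_biInter fun j _ => (measurableSet_coe (A j))).nullMeasurableSet]
      simp only [preimage_iInter]
    simp only [h2] at h1
    have h3 : Tendsto (fun n => ∑ j ∈ F, μ.real ((t n ⁻¹' (A j : Set X)) ∆ (G j : Set X))) atTop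
        (𝓝 0) := by
      simpa using tendsto_finsetSum F fun j _ => hG' j
    have h4 := ge_of_tendsto' h3 h1
    have h5 := sub_eq_zero.1 (abs_eq_zero.1 (le_antisymm h4 (abs_nonneg _)))
    exact ((measureReal_eq_measureReal_iff).1 h5).symm
  have hiso : AEIso μ (μ.map a) a r := AEIso.of_left_inv ⟨ha, rfl⟩ hr hrA
  have hgmp : MeasurePreserving g μ (μ.map a) := ⟨hg, hlaw⟩
  have hf : MeasurePreserving (fun x => r (g x)) μ μ := hiso.mp_inv.comp hgmp
  refine ⟨fun x => r (g x), hf, ?_⟩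
  have hfA : ∀ i, ((fun x => r (g x)) ⁻¹' (A i : Set X) : Set X) =ᵐ[μ] (G i : Set X) := by
    intro i
    filter_upwards [hgmp.quasiMeasurePreserving.ae hiso.right_inv] with x hx
    exact congrFun hx i
  have hlim : ∀ i, Tendsto (fun n => μ.real ((t n ⁻¹' (A i : Set X)) ∆
      ((fun x => r (g x)) ⁻¹' (A i : Set X)))) atTop (𝓝 0) := fun i => by
    refine (hG' i).congr fun n => measureReal_congr ?_
    exact (ae_eq_refl _).symmDiff (hfA i).symm
  intro B hB
  rw [Metric.tendsto_atTop]
  intro ε hε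
  obtain ⟨i, hi⟩ := Metric.denseRange_iff.1 hA ⟨B, hB⟩ (ε / 4) (by positivity)
  change μ.real (B ∆ (A i : Set X)) < ε / 4 at hi
  obtain ⟨N, hN⟩ := Metric.tendsto_atTop.1 (hlim i) (ε / 2) (by positivity)
  refine ⟨N, fun n hn => ?_⟩
  have h1 := hN n hn
  rw [Real.dist_0_eq_abs, abs_of_nonneg measureReal_nonneg] at h1 ⊢
  have := measureReal_preimage_symmDiff_le (ht n) hf hB (measurableSet_coe (A i))
  linarith

/-- Limits of mutually inverse transformations are mutually inverse. -/
theorem ae_eq_of_tendsto {s s' : ℕ → X → X} (hs : ∀ n, MeasurePreserving (s n) μ μ)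
    (hs' : ∀ n, MeasurePreserving (s' n) μ μ) (hinv : ∀ n x, s n (s' n x) = x)
    {f f' : X → X} (hf : MeasurePreserving f μ μ)
    (h : ∀ B, MeasurableSet B → Tendsto (fun n => μ.real ((s n ⁻¹' B) ∆ (f ⁻¹' B))) atTop (𝓝 0))
    (h' : ∀ B, MeasurableSet B →
      Tendsto (fun n => μ.real ((s' n ⁻¹' B) ∆ (f' ⁻¹' B))) atTop (𝓝 0)) :
    ∀ᵐ x ∂μ, f (f' x) = x := by
  refine EventuallyEq.of_forall_separating_preimage (f := fun x => f (f' x)) (g := id)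
    MeasurableSet fun U hU => ?_
  rw [← measure_symmDiff_eq_zero_iff, ← measureReal_eq_zero_iff]
  have hfU := hf.measurable hU
  have h1 := (h' _ hfU).add (h U hU)
  rw [add_zero] at h1
  refine le_antisymm (ge_of_tendsto' h1 fun n => ?_) measureReal_nonneg
  -- Pulling back by `s' n` cancels `s n`, so `U` is close to `(s' n)⁻¹ (f⁻¹ U)`, which in turn is
  -- close to `f'⁻¹ (f⁻¹ U)`.
  have h2 : μ.real ((s n ⁻¹' U) ∆ (f ⁻¹' U)) = μ.real (U ∆ (s' n ⁻¹' (f ⁻¹' U))) := by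
    rw [← (hs' n).measureReal_preimage ((hs n).measurable hU |>.symmDiff hfU).nullMeasurableSet,
      preimage_symmDiff, ← preimage_comp]
    congr 2
    ext x
    simp [hinv]
  rw [h2, symmDiff_comm _ (f' ⁻¹' (f ⁻¹' U)), symmDiff_comm U, add_comm]
  have := measureReal_symmDiff_le (μ := μ) (s := f' ⁻¹' (f ⁻¹' U)) (t := s' n ⁻¹' (f ⁻¹' U)) U
  rw [add_comm]
  exact this

end MeasuredSets

/-! ### The Halmos metric: completeness, and continuity of join entropies -/

section HalmosTopology

set_option linter.unusedSectionVars false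

variable {X : Type*} [MeasurableSpace X] {μ : Measure X}

theorem image_eq_preimage_inv (R : mpGroup μ) (B : Set X) :
    (R : Equiv.Perm X) '' B = ((R⁻¹ : mpGroup μ) : Equiv.Perm X) ⁻¹' B :=
  Equiv.image_eq_preimage_symm _ _

theorem measurableSet_image (R : mpGroup μ) {B : Set X} (hB : MeasurableSet B) :
    MeasurableSet ((R : Equiv.Perm X) '' B) := by
  rw [image_eq_preimage_inv]
  exact (mpGroup_mp R⁻¹).measurable hB

theorem moveDist_mk_preimage (B : Set X) (S T : mpGroup μ) :
    moveDist B (S : Aut μ) (T : Aut μ) =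
      μ.real ((((S⁻¹ : mpGroup μ) : Equiv.Perm X) ⁻¹' B) ∆
        (((T⁻¹ : mpGroup μ) : Equiv.Perm X) ⁻¹' B)) := by
  rw [moveDist_mk, image_eq_preimage_inv, image_eq_preimage_inv]

theorem moveDist_inv_mk (B : Set X) (S T : mpGroup μ) :
    moveDist B (S : Aut μ)⁻¹ (T : Aut μ)⁻¹ =
      μ.real (((S : Equiv.Perm X) ⁻¹' B) ∆ ((T : Equiv.Perm X) ⁻¹' B)) := by
  rw [← QuotientGroup.mk_inv, ← QuotientGroup.mk_inv, moveDist_mk_preimage, inv_inv, inv_inv]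

theorem moveDist_mul_right (B : Set X) (S T : Aut μ) (R : mpGroup μ) :
    moveDist B (S * (R : Aut μ)) (T * (R : Aut μ)) = moveDist ((R : Equiv.Perm X) '' B) S T := by
  induction S using QuotientGroup.induction_on with | H S => ?_
  induction T using QuotientGroup.induction_on with | H T => ?_
  rw [← QuotientGroup.mk_mul, ← QuotientGroup.mk_mul, moveDist_mk, moveDist_mk, ← image_comp,
    ← image_comp]
  rfl

theorem moveDist_mul_left {B : Set X} (hB : MeasurableSet B) (U S T : Aut μ) :
    moveDist B (U * S) (U * T) = moveDist B S T := by
  induction U using QuotientGroup.induction_on with | H U => ?_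
  induction S using QuotientGroup.induction_on with | H S => ?_
  induction T using QuotientGroup.induction_on with | H T => ?_
  have h : ∀ R : mpGroup μ, ((U * R : mpGroup μ) : Equiv.Perm X) '' B =
      (U : Equiv.Perm X) '' ((R : Equiv.Perm X) '' B) := fun R => by
    rw [← image_comp]; rfl
  rw [← QuotientGroup.mk_mul, ← QuotientGroup.mk_mul, moveDist_mk, moveDist_mk, h, h,
    ← image_symmDiff (U : Equiv.Perm X).injective, image_eq_preimage_inv,
    (mpGroup_mp U⁻¹).measureReal_preimage
      ((measurableSet_image S hB).symmDiff (measurableSet_image T hB)).nullMeasurableSet]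

variable [IsProbabilityMeasure μ]

theorem moveDist_le_add {B C : Set X} (hB : MeasurableSet B) (hC : MeasurableSet C)
    (S T : Aut μ) : moveDist B S T ≤ 2 * μ.real (B ∆ C) + moveDist C S T := by
  induction S using QuotientGroup.induction_on with | H S => ?_
  induction T using QuotientGroup.induction_on with | H T => ?_
  rw [moveDist_mk_preimage, moveDist_mk_preimage]
  exact measureReal_preimage_symmDiff_le (mpGroup_mp S⁻¹) (mpGroup_mp T⁻¹) hB hC

theorem moveDist_add_le_halmosDist (A : ℕ → MeasuredSets μ) (S T : Aut μ) (i : ℕ) :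
    moveDist (A i : Set X) S T + moveDist (A i : Set X) S⁻¹ T⁻¹ ≤
      2 ^ (i + 1) * halmosDist A S T := by
  have h := (halmos_summable A S T).le_tsum i fun j _ => by
    have := moveDist_nonneg (A j : Set X) S T
    have := moveDist_nonneg (A j : Set X) S⁻¹ T⁻¹
    positivity
  have h2 := mul_le_mul_of_nonneg_left h (by positivity : (0 : ℝ) ≤ 2 ^ (i + 1))
  rw [← mul_assoc, ← mul_pow] at h2
  norm_num at h2
  simpa [halmosDist] using h2

theorem moveDist_le_halmosDist (A : ℕ → MeasuredSets μ) (S T : Aut μ) (i : ℕ) :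
    moveDist (A i : Set X) S T ≤ 2 ^ (i + 1) * halmosDist A S T := by
  have := moveDist_add_le_halmosDist A S T i
  have := moveDist_nonneg (A i : Set X) S⁻¹ T⁻¹
  linarith

theorem moveDist_inv_le_halmosDist (A : ℕ → MeasuredSets μ) (S T : Aut μ) (i : ℕ) :
    moveDist (A i : Set X) S⁻¹ T⁻¹ ≤ 2 ^ (i + 1) * halmosDist A S T := by
  have := moveDist_add_le_halmosDist A S T i
  have := moveDist_nonneg (A i : Set X) S T
  linarith

theorem tendsto_halmosDist (A : ℕ → MeasuredSets μ) {u : ℕ → Aut μ} {S : Aut μ}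
    (h : ∀ i, Tendsto (fun n => moveDist (A i : Set X) (u n) S) atTop (𝓝 0))
    (h' : ∀ i, Tendsto (fun n => moveDist (A i : Set X) (u n)⁻¹ S⁻¹) atTop (𝓝 0)) :
    Tendsto (fun n => halmosDist A (u n) S) atTop (𝓝 0) := by
  have := tendsto_tsum_of_dominated_convergence (𝓕 := atTop)
    (f := fun n i => (1 / 2 : ℝ) ^ (i + 1) *
      (moveDist (A i : Set X) (u n) S + moveDist (A i : Set X) (u n)⁻¹ S⁻¹))
    (g := fun _ => 0) (bound := fun i => (1 / 2 : ℝ) ^ i)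
    (summable_geometric_of_lt_one (by norm_num) (by norm_num))
    (fun i => by simpa using ((h i).add (h' i)).const_mul ((1 / 2 : ℝ) ^ (i + 1)))
    (Eventually.of_forall fun n i => by
      have h0 := moveDist_nonneg (A i : Set X) (u n) S
      have h0' := moveDist_nonneg (A i : Set X) (u n)⁻¹ S⁻¹
      have h1 := moveDist_le_one (A i : Set X) (u n) S
      have h2 := moveDist_le_one (A i : Set X) (u n)⁻¹ S⁻¹
      rw [Real.norm_of_nonneg (by positivity)]
      calc (1 / 2 : ℝ) ^ (i + 1) *
            (moveDist (A i : Set X) (u n) S + moveDist (A i : Set X) (u n)⁻¹ S⁻¹)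
          ≤ (1 / 2 : ℝ) ^ (i + 1) * 2 := by gcongr; linarith
        _ = (1 / 2 : ℝ) ^ i := by ring)
  simpa [halmosDist] using this

variable [StandardBorelSpace X]

theorem cauchySeq_measuredSet (A : ℕ → MeasuredSets μ) (hA : DenseRange A) {u : ℕ → Aut μ}
    (hu : letI := halmosMetric A hA; CauchySeq u) {t : ℕ → X → X}
    (ht : ∀ n, MeasurePreserving (t n) μ μ) (i : ℕ)
    (h : ∀ m n, μ.real ((t m ⁻¹' (A i : Set X)) ∆ (t n ⁻¹' (A i : Set X))) ≤
      2 ^ (i + 1) * halmosDist A (u m) (u n)) :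
    CauchySeq fun n =>
      measuredSet μ (t n ⁻¹' (A i : Set X)) ((ht n).measurable (measurableSet_coe (A i))) := by
  let _ := halmosMetric A hA
  rw [Metric.cauchySeq_iff] at hu ⊢
  intro ε hε
  obtain ⟨N, hN⟩ := hu (ε / 2 ^ (i + 1)) (by positivity)
  refine ⟨N, fun m hm n hn => (h m n).trans_lt ?_⟩
  have := hN m hm n hn
  rw [lt_div_iff₀ (by positivity)] at this
  rw [mul_comm]
  exact this

/-- The Halmos metric is complete. -/
theorem completeSpace_halmosMetric [NullSingletonClass μ] (A : ℕ → MeasuredSets μ)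
    (hA : DenseRange A) : letI := halmosMetric A hA; CompleteSpace (Aut μ) := by
  let _ := halmosMetric A hA
  refine Metric.complete_of_cauchySeq_tendsto fun u hu => ?_
  choose s hs using fun n => QuotientGroup.mk_surjective (u n)
  obtain rfl : (fun n => (s n : Aut μ)) = u := funext hs
  -- The metric controls both `s n` and its inverse, so each sequence has a limit. The two limits
  -- are mutually inverse almost everywhere, hence come from a genuine permutation.
  obtain ⟨f, hf, hfl⟩ := exists_limit_measurePreserving A hA
    (t := fun n => (s n : Equiv.Perm X)) (fun n => mpGroup_mp (s n)) fun i =>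
      cauchySeq_measuredSet A hA hu (fun n => mpGroup_mp (s n)) i fun m n => by
        have := moveDist_inv_le_halmosDist A (s m : Aut μ) (s n : Aut μ) i
        rwa [moveDist_inv_mk] at this
  obtain ⟨f', hf', hfl'⟩ := exists_limit_measurePreserving A hA
    (t := fun n => ((s n)⁻¹ : mpGroup μ)) (fun n => mpGroup_mp (s n)⁻¹) fun i =>
      cauchySeq_measuredSet A hA hu (fun n => mpGroup_mp (s n)⁻¹) i fun m n => by
        have := moveDist_le_halmosDist A (s m : Aut μ) (s n : Aut μ) i
        rwa [moveDist_mk_preimage] at this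
  have h1 : ∀ᵐ x ∂μ, f (f' x) = x :=
    ae_eq_of_tendsto (fun n => mpGroup_mp (s n)) (fun n => mpGroup_mp (s n)⁻¹)
      (fun n x => by simp) hf hfl hfl'
  have h2 : ∀ᵐ x ∂μ, f' (f x) = x :=
    ae_eq_of_tendsto (fun n => mpGroup_mp (s n)⁻¹) (fun n => mpGroup_mp (s n))
      (fun n x => by simp) hf' hfl' hfl
  obtain ⟨S, hS⟩ := AEIso.exists_mpGroup ⟨hf, hf', h2, h1⟩
  have hS' : ∀ᵐ x ∂μ, ((S⁻¹ : mpGroup μ) : Equiv.Perm X) x = f' x := by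
    filter_upwards [hf'.quasiMeasurePreserving.ae hS, h1] with x hx hx1
    have hx2 : (S : Equiv.Perm X) (f' x) = x := hx.trans hx1
    change (S : Equiv.Perm X).symm x = f' x
    rw [Equiv.symm_apply_eq, hx2]
  have hpre : ∀ {a b : X → X}, (∀ᵐ x ∂μ, a x = b x) → ∀ B : Set X,
      (b ⁻¹' B : Set X) =ᵐ[μ] (a ⁻¹' B : Set X) := by
    intro a b hab B
    filter_upwards [hab] with x hx
    exact congrArg (· ∈ B) hx.symm
  refine ⟨(S : Aut μ), tendsto_iff_dist_tendsto_zero.2 (tendsto_halmosDist A (fun i => ?_)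
    fun i => ?_)⟩
  · refine (hfl' _ (measurableSet_coe (A i))).congr fun n => ?_
    rw [moveDist_mk_preimage]
    exact measureReal_congr ((ae_eq_refl _).symmDiff (hpre hS' _))
  · refine (hfl _ (measurableSet_coe (A i))).congr fun n => ?_
    rw [moveDist_inv_mk]
    exact measureReal_congr ((ae_eq_refl _).symmDiff (hpre hS _))

theorem tendsto_moveDist (A : ℕ → MeasuredSets μ) (hA : DenseRange A) {B : Set X}
    (hB : MeasurableSet B) (T₀ : Aut μ) : letI := halmosMetric A hA;
    Tendsto (fun T => moveDist B T T₀) (𝓝 T₀) (𝓝 0) := by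
  let _ := halmosMetric A hA
  rw [Metric.tendsto_nhds_nhds]
  intro ε hε
  obtain ⟨i, hi⟩ := Metric.denseRange_iff.1 hA ⟨B, hB⟩ (ε / 4) (by positivity)
  change μ.real (B ∆ (A i : Set X)) < ε / 4 at hi
  refine ⟨ε / 2 / 2 ^ (i + 1), by positivity, fun T hT => ?_⟩
  change halmosDist A T T₀ < _ at hT
  rw [lt_div_iff₀ (by positivity)] at hT
  rw [Real.dist_0_eq_abs, abs_of_nonneg (moveDist_nonneg _ _ _)]
  have h1 := moveDist_le_add hB (measurableSet_coe (A i)) T T₀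
  have h2 := moveDist_le_halmosDist A T T₀ i
  linarith

/-- Compare `T * T ^ k` with `T₀ * T₀ ^ k` through `T * T₀ ^ k`. Left multiplication by `T` leaves
the distance unchanged, and right multiplication by `T₀ ^ k` only moves the set `B`. -/
theorem tendsto_moveDist_pow (A : ℕ → MeasuredSets μ) (hA : DenseRange A) {B : Set X}
    (hB : MeasurableSet B) (T₀ : Aut μ) (k : ℕ) : letI := halmosMetric A hA;
    Tendsto (fun T => moveDist B (T ^ k) (T₀ ^ k)) (𝓝 T₀) (𝓝 0) := by
  let _ := halmosMetric A hA
  induction k with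
  | zero => simp [moveDist_self]
  | succ k ih =>
    obtain ⟨R, hR⟩ := QuotientGroup.mk_surjective (T₀ ^ k)
    have h1 := ih.add (tendsto_moveDist A hA (measurableSet_image R hB) T₀)
    rw [add_zero] at h1
    refine squeeze_zero (fun T => moveDist_nonneg _ _ _) (fun T => ?_) h1
    have h2 := moveDist_triangle B (T * T ^ k) (T * T₀ ^ k) (T₀ * T₀ ^ k)
    rw [moveDist_mul_left hB, ← hR, moveDist_mul_right] at h2
    rw [pow_succ', pow_succ', ← hR]
    exact h2

theorem joinLabel_preimage (T : mpGroup μ) (P : Finset ℤ) {n : ℕ} (f : X → Fin n)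
    (c : P → Fin n) :
    joinLabel T P f ⁻¹' {c} = ⋂ p ∈ (Finset.univ : Finset P),
      ((T ^ (p : ℤ) : mpGroup μ) : Equiv.Perm X) '' (f ⁻¹' {c p}) := by
  ext x
  simp only [image_eq_preimage_inv, mem_preimage, mem_singleton_iff, Finset.mem_univ,
    iInter_true, mem_iInter, ← zpow_neg]
  exact funext_iff

/-- The entropy of a join of non-negative iterates depends continuously on the automorphism. -/
theorem continuous_joinEntropy (A : ℕ → MeasuredSets μ) (hA : DenseRange A) {P : Finset ℤ}
    (hP : ∀ p ∈ P, 0 ≤ p) {n : ℕ} {f : X → Fin n} (hf : Measurable f) :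
    letI := halmosMetric A hA; Continuous fun T : Aut μ => joinEntropy T P f := by
  let _ := halmosMetric A hA
  have hout : ∀ T : Aut μ, joinEntropy T P f =
      ∑ c, Real.negMulLog (μ.real (joinLabel (Quotient.out T) P f ⁻¹' {c})) := fun T => by
    conv_lhs => rw [← QuotientGroup.out_eq' T]
    rfl
  simp only [hout]
  refine continuous_finsetSum _ fun c _ => Real.continuous_negMulLog.comp ?_
  rw [continuous_iff_continuousAt]
  intro T₀
  have hm : ∀ p : P, MeasurableSet (f ⁻¹' {c p}) := fun p => hf (measurableSet_singleton _)
  have h1 : Tendsto (fun T : Aut μ => ∑ p : P, moveDist (f ⁻¹' {c p}) (T ^ (p : ℤ).toNat)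
      (T₀ ^ (p : ℤ).toNat)) (𝓝 T₀) (𝓝 0) := by
    simpa using tendsto_finsetSum Finset.univ fun p _ =>
      tendsto_moveDist_pow A hA (hm p) T₀ (p : ℤ).toNat
  refine tendsto_iff_dist_tendsto_zero.2 (squeeze_zero (fun _ => dist_nonneg) (fun T => ?_) h1)
  beta_reduce
  rw [Real.dist_eq, joinLabel_preimage, joinLabel_preimage]
  refine (abs_measureReal_biInter_sub_le _ (fun p => measurableSet_image _ (hm p))
    fun p => measurableSet_image _ (hm p)).trans_eq (Finset.sum_congr rfl fun p _ => ?_)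
  have h2 : ∀ T : Aut μ, T ^ (p : ℤ).toNat = ((Quotient.out T ^ (p : ℤ) : mpGroup μ) : Aut μ) := by
    intro T
    rw [QuotientGroup.mk_zpow, ← zpow_natCast, Int.toNat_of_nonneg (hP p p.2)]
    conv_lhs => rw [← QuotientGroup.out_eq' T]
  rw [h2, h2, moveDist_mk]

end HalmosTopology

/-! ### Entropy along arithmetic progressions, uniformly over a compact set -/

section JoinEntropy

set_option linter.unusedSectionVars false

variable {X : Type*} [MeasurableSpace X] {μ : Measure X} [IsProbabilityMeasure μ]

theorem joinEntropy_mk (T : mpGroup μ) (P : Finset ℤ) {n : ℕ} (f : X → Fin n) :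
    joinEntropy (T : Aut μ) P f =
      famEntropy μ (fun (p : ℤ) x => f (((T ^ (-p) : mpGroup μ) : Equiv.Perm X) x)) P := by
  rw [famEntropy_eq]
  rfl

theorem measurable_iterate (T : mpGroup μ) {n : ℕ} {f : X → Fin n} (hf : Measurable f) (p : ℤ) :
    Measurable fun x => f (((T ^ (-p) : mpGroup μ) : Equiv.Perm X) x) :=
  hf.comp (mpGroup_mp _).measurable

theorem joinEntropy_mono (T : Aut μ) {P Q : Finset ℤ} (h : P ⊆ Q) {n : ℕ} {f : X → Fin n}
    (hf : Measurable f) : joinEntropy T P f ≤ joinEntropy T Q f := by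
  induction T using QuotientGroup.induction_on with | H T => ?_
  rw [joinEntropy_mk, joinEntropy_mk]
  exact famEntropy_mono (measurable_iterate T hf) h

theorem joinEntropy_union_le (T : Aut μ) (P Q : Finset ℤ) {n : ℕ} {f : X → Fin n}
    (hf : Measurable f) : joinEntropy T (P ∪ Q) f ≤ joinEntropy T P f + joinEntropy T Q f := by
  induction T using QuotientGroup.induction_on with | H T => ?_
  simp only [joinEntropy_mk]
  exact famEntropy_union_le (measurable_iterate T hf) P Q

theorem joinEntropy_empty (T : Aut μ) {n : ℕ} {f : X → Fin n} : joinEntropy T ∅ f = 0 := by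
  induction T using QuotientGroup.induction_on with | H T => ?_
  rw [joinEntropy_mk, famEntropy_empty]

theorem joinEntropy_image_add_le (T : Aut μ) (P : Finset ℤ) (a : ℤ) {n : ℕ} {f : X → Fin n}
    (hf : Measurable f) : joinEntropy T (P.image (· + a)) f ≤ joinEntropy T P f := by
  induction T using QuotientGroup.induction_on with | H T => ?_
  have hmem : ∀ q : (P.image (· + a) : Finset ℤ), (q : ℤ) - a ∈ P := fun q => by
    obtain ⟨p, hp, hpq⟩ := Finset.mem_image.1 q.2
    rw [← hpq]
    simpa using hp
  change partEntropy μ (joinLabel T (P.image (· + a)) f) ≤ partEntropy μ (joinLabel T P f)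
  have hm : Measurable (joinLabel T P f) := measurable_fam (measurable_iterate T hf) P
  rw [← partEntropy_comp_measurePreserving (mpGroup_mp (T ^ (-a))) hm]
  refine le_of_eq_of_le ?_ (partEntropy_comp_le (hm.comp (mpGroup_mp (T ^ (-a))).measurable)
    (fun (c : P → Fin n) (q : (P.image (· + a) : Finset ℤ)) => c ⟨q - a, hmem q⟩))
  congr 1
  funext x q
  change f _ = f (((T ^ (-((q : ℤ) - a)) * T ^ (-a) : mpGroup μ) : Equiv.Perm X) x)
  rw [← zpow_add]
  congr 4
  ring

/-- The finite arithmetic progression `{j k : k < L}`. -/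
def progression (j L : ℕ) : Finset ℤ := (Finset.range L).image fun k : ℕ => ((j * k : ℕ) : ℤ)

theorem progression_nonneg (j L : ℕ) : ∀ p ∈ progression j L, 0 ≤ p := by
  intro p hp
  obtain ⟨k, _, rfl⟩ := Finset.mem_image.1 hp
  positivity

theorem progression_subset_Icc (j L : ℕ) :
    progression j L ⊆ Finset.Icc (0 : ℤ) ((j * L : ℕ) : ℤ) := by
  intro p hp
  obtain ⟨k, hk, rfl⟩ := Finset.mem_image.1 hp
  rw [Finset.mem_Icc]
  refine ⟨by positivity, ?_⟩
  exact_mod_cast Nat.mul_le_mul_left j (Finset.mem_range.1 hk).le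

theorem progression_add (j K L : ℕ) : progression j (K + L) =
    progression j K ∪ (progression j L).image (· + ((j * K : ℕ) : ℤ)) := by
  ext p
  simp only [progression, Finset.mem_image, Finset.mem_range, Finset.mem_union,
    exists_exists_and_eq_and]
  constructor
  · rintro ⟨k, hk, rfl⟩
    rcases lt_or_ge k K with h | h
    · exact Or.inl ⟨k, h, rfl⟩
    · refine Or.inr ⟨k - K, by omega, ?_⟩
      obtain ⟨m, rfl⟩ := Nat.exists_eq_add_of_le h
      push_cast
      simp
      ring
  · rintro (⟨k, hk, rfl⟩ | ⟨k, hk, rfl⟩)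
    · exact ⟨k, by omega, rfl⟩
    · refine ⟨k + K, by omega, ?_⟩
      push_cast
      ring

theorem progression_card_le (j L : ℕ) : (progression j L).card ≤ L :=
  Finset.card_image_le.trans_eq (Finset.card_range L)

/-- The long progression splits into `m` translates of the short one, and translating does not
increase the join entropy. -/
theorem joinEntropy_progression_mul_le (T : Aut μ) (j m L : ℕ) {n : ℕ} {f : X → Fin n}
    (hf : Measurable f) :
    joinEntropy T (progression j (m * L)) f ≤ m * joinEntropy T (progression j L) f := by
  induction m with
  | zero => simp [progression, joinEntropy_empty]
  | succ m ih =>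
    rw [Nat.succ_mul, progression_add]
    refine (joinEntropy_union_le T _ _ hf).trans ?_
    have := joinEntropy_image_add_le T (progression j L) ((j * (m * L) : ℕ) : ℤ) hf
    push_cast at this ⊢
    linarith

/-- An automorphism of zero entropy has arbitrarily small entropy per step along long arithmetic
progressions. -/
theorem exists_joinEntropy_progression_lt {T : Aut μ} (hT : T ∈ zeroEntropy μ) {n : ℕ}
    {f : X → Fin n} (hf : Measurable f) {j : ℕ} (hj : 0 < j) {δ : ℝ} (hδ : 0 < δ) :
    ∃ L : ℕ, 0 < L ∧ joinEntropy T (progression j L) f < δ * L := by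
  have hlim : limsup (fun N : ℕ => ((joinEntropy T (Finset.Icc (0 : ℤ) N) f /
      ((Finset.Icc (0 : ℤ) N).card : ℝ) : ℝ) : EReal)) atTop ≤ 0 := by
    have h0 : entropy T = 0 := hT
    rw [← h0, entropy, pEntropy]
    exact le_iSup₂_of_le (f := fun (n : ℕ) (f : {f : X → Fin n // Measurable f}) =>
      limsup (fun j : ℕ => ((joinEntropy T (Finset.Icc (0 : ℤ) j) f.1 /
        ((Finset.Icc (0 : ℤ) j).card : ℝ) : ℝ) : EReal)) atTop) n ⟨f, hf⟩ le_rfl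
  -- The progression of length `N + 1` lies in an interval of `j * (N + 1) + 1 ≤ (j + 1) * (N + 1)`
  -- integers, so a rate of `δ / (j + 1)` per integer gives `δ` per term.
  have hpos : (0 : EReal) < ((δ / (j + 1) : ℝ) : EReal) := by
    exact_mod_cast (by positivity : (0 : ℝ) < δ / (j + 1))
  obtain ⟨N, hN⟩ := eventually_atTop.1 (eventually_lt_of_limsup_lt (hlim.trans_lt hpos))
  refine ⟨N + 1, Nat.succ_pos N, ?_⟩
  have h1 := hN (j * (N + 1)) ((Nat.le_succ N).trans (Nat.le_mul_of_pos_left _ hj))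
  have hcard : ((Finset.Icc (0 : ℤ) ((j * (N + 1) : ℕ) : ℤ)).card : ℝ) = j * (N + 1) + 1 := by
    rw [Int.card_Icc]
    have : (((j * (N + 1) : ℕ) : ℤ) + 1 - 0).toNat = j * (N + 1) + 1 := by omega
    rw [this]
    push_cast
    ring
  rw [EReal.coe_lt_coe_iff, hcard, div_lt_iff₀ (by positivity)] at h1
  refine (joinEntropy_mono T (progression_subset_Icc j (N + 1)) hf).trans_lt (h1.trans_le ?_)
  rw [div_mul_eq_mul_div, div_le_iff₀ (by positivity), mul_assoc]
  refine mul_le_mul_of_nonneg_left ?_ hδ.le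
  have : (0 : ℝ) ≤ N := Nat.cast_nonneg N
  push_cast
  nlinarith

variable [StandardBorelSpace X]

/-- A good length for one automorphism is good on a neighbourhood, and its multiples stay good.
Keeping all multiples in the statement lets finitely many pieces share a common length. -/
theorem exists_uniform_joinEntropy_lt (A : ℕ → MeasuredSets μ) (hA : DenseRange A)
    {K : Set (Aut μ)} (hKE : K ⊆ zeroEntropy μ) (hK : letI := halmosMetric A hA; IsCompact K)
    {n : ℕ} {f : X → Fin n} (hf : Measurable f) {j : ℕ} (hj : 0 < j) {δ : ℝ} (hδ : 0 < δ) :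
    ∃ L : ℕ, 0 < L ∧ ∀ m : ℕ, 0 < m → ∀ T ∈ K,
      joinEntropy T (progression j (m * L)) f < δ * (m * L : ℕ) := by
  let _ := halmosMetric A hA
  have hmul : ∀ {T : Aut μ} {L m : ℕ}, 0 < m → joinEntropy T (progression j L) f < δ * L →
      joinEntropy T (progression j (m * L)) f < δ * (m * L : ℕ) := by
    intro T L m hm h
    refine (joinEntropy_progression_mul_le T j m L hf).trans_lt ?_
    have : (0 : ℝ) < m := by exact_mod_cast hm
    push_cast
    nlinarith
  -- For a union of two pieces with lengths `L` and `L'` the length `L * L'` is a multiple of both.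
  refine hK.induction_on (p := fun s => ∃ L : ℕ, 0 < L ∧ ∀ m : ℕ, 0 < m → ∀ T ∈ s,
      joinEntropy T (progression j (m * L)) f < δ * (m * L : ℕ)) ?_ ?_ ?_ ?_
  · exact ⟨1, one_pos, fun _ _ _ h => h.elim⟩
  · rintro s t hst ⟨L, hL, h⟩
    exact ⟨L, hL, fun m hm T hT => h m hm T (hst hT)⟩
  · rintro s t ⟨L, hL, h⟩ ⟨L', hL', h'⟩
    refine ⟨L * L', Nat.mul_pos hL hL', fun m hm T hT => ?_⟩
    rcases hT with hT | hT
    · have := h (m * L') (Nat.mul_pos hm hL') T hT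
      rwa [mul_assoc, mul_comm L'] at this
    · have := h' (m * L) (Nat.mul_pos hm hL) T hT
      rwa [mul_assoc] at this
  · intro T hT
    obtain ⟨L, hL, h⟩ := exists_joinEntropy_progression_lt (hKE hT) hf hj hδ
    have hopen : IsOpen {T' : Aut μ | joinEntropy T' (progression j L) f < δ * L} :=
      isOpen_lt (continuous_joinEntropy A hA (progression_nonneg j L) hf) continuous_const
    exact ⟨_, mem_nhdsWithin_of_mem_nhds (hopen.mem_nhds h), L, hL, fun m hm T' hT' => hmul hm hT'⟩

open Classical in
/-- The partition `{B, Bᶜ}`. -/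
noncomputable def indicatorLabel (B : Set X) : X → Fin 2 := fun x => if x ∈ B then 1 else 0

theorem indicatorLabel_preimage (B : Set X) : indicatorLabel B ⁻¹' {1} = B := by
  ext x
  by_cases h : x ∈ B <;> simp [indicatorLabel, h]

theorem measurable_indicatorLabel {B : Set X} (hB : MeasurableSet B) :
    Measurable (indicatorLabel B) :=
  Measurable.ite hB measurable_const measurable_const

theorem partEntropy_indicatorLabel {B : Set X} (hB : MeasurableSet B) :
    partEntropy μ (indicatorLabel B) = Real.binEntropy (μ.real B) := by
  rw [partEntropy_fin_two (measurable_indicatorLabel hB), indicatorLabel_preimage]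

theorem joinEntropy_indicatorLabel_le (T : Aut μ) (P : Finset ℤ) {B C : Set X}
    (hB : MeasurableSet B) (hC : MeasurableSet C) :
    joinEntropy T P (indicatorLabel B) ≤
      joinEntropy T P (indicatorLabel C) + P.card * Real.binEntropy (μ.real (B ∆ C)) := by
  induction T using QuotientGroup.induction_on with | H T => ?_
  rw [joinEntropy_mk, joinEntropy_mk]
  have hD := measurable_indicatorLabel (hB.symmDiff hC)
  refine (famEntropy_le_add_sum (measurable_iterate T (measurable_indicatorLabel hC))
    (measurable_iterate T hD) (fun a d => if d = 0 then a else 1 - a) ?_ P).trans_eq ?_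
  · intro p x
    generalize ((T ^ (-p) : mpGroup μ) : Equiv.Perm X) x = y
    by_cases h1 : y ∈ B <;> by_cases h2 : y ∈ C <;> simp [indicatorLabel, mem_symmDiff, h1, h2]
  · congr 1
    rw [← nsmul_eq_mul, ← Finset.sum_const]
    refine Finset.sum_congr rfl fun p _ => ?_
    rw [partEntropy_comp_measurePreserving (mpGroup_mp _) hD,
      partEntropy_indicatorLabel (hB.symmDiff hC)]

/-- `J` carries the whole join for the conjugate to the join for `S` with `J B` in place of `B`, and
it preserves the measure. -/
theorem joinEntropy_conj (J : mpGroup μ) (S : Aut μ) (P : Finset ℤ) {B : Set X}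
    (hB : MeasurableSet B) :
    joinEntropy ((J : Aut μ)⁻¹ * S * (J : Aut μ)) P (indicatorLabel B) =
      joinEntropy S P (indicatorLabel ((J : Equiv.Perm X) '' B)) := by
  induction S using QuotientGroup.induction_on with | H S => ?_
  change partEntropy μ (joinLabel (J⁻¹ * S * J) P (indicatorLabel B)) =
    partEntropy μ (joinLabel S P (indicatorLabel ((J : Equiv.Perm X) '' B)))
  have hm : Measurable (joinLabel S P (indicatorLabel ((J : Equiv.Perm X) '' B))) :=
    measurable_fam (measurable_iterate S (measurable_indicatorLabel (measurableSet_image J hB))) P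
  rw [← partEntropy_comp_measurePreserving (mpGroup_mp J) hm]
  congr 1
  funext x p
  have h : (J⁻¹ * S * J) ^ (-(p : ℤ)) = J⁻¹ * S ^ (-(p : ℤ)) * J := by
    have := conj_zpow (i := -(p : ℤ)) (a := J⁻¹) (b := S)
    rwa [inv_inv] at this
  change indicatorLabel B (((J⁻¹ * S * J) ^ (-(p : ℤ)) : mpGroup μ).1 x) =
    indicatorLabel ((J : Equiv.Perm X) '' B) ((S ^ (-(p : ℤ)) : mpGroup μ).1 (J.1 x))
  rw [h, image_eq_preimage_inv]
  rfl

end JoinEntropy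

/-! ### Bernoulli shifts and independence of disjoint sets of coordinates -/

section Bernoulli

set_option linter.unusedSectionVars false

variable {W : Type*} [mW : MeasurableSpace W] (Q : Measure W) [IsProbabilityMeasure Q]

/-- The shift by `k` of two-sided sequences. -/
def shiftBy (k : ℤ) (y : ℤ → W) : ℤ → W := fun n => y (n + k)

/-- The Bernoulli measure with one-dimensional distribution `Q`. -/
noncomputable abbrev bernoulli : Measure (ℤ → W) := Measure.infinitePi fun _ : ℤ => Q

theorem shiftBy_shiftBy (k l : ℤ) (y : ℤ → W) : shiftBy k (shiftBy l y) = shiftBy (k + l) y := by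
  funext n
  simp only [shiftBy, add_assoc]

theorem shiftBy_zero (y : ℤ → W) : shiftBy 0 y = y := by
  funext n
  simp only [shiftBy, add_zero]

theorem measurePreserving_shiftBy (k : ℤ) :
    MeasurePreserving (shiftBy k) (bernoulli Q) (bernoulli Q) :=
  ⟨measurable_pi_lambda _ fun _ => measurable_pi_apply _,
    Measure.map_infinitePi_infinitePi_of_inj (P := fun _ : ℤ => Q) (add_left_injective k)⟩

theorem measurePreserving_coord (i : ℤ) :
    MeasurePreserving (fun y : ℤ → W => y i) (bernoulli Q) Q :=
  measurePreserving_eval_infinitePi (fun _ : ℤ => Q) i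

theorem aeIso_shiftBy (k : ℤ) :
    AEIso (bernoulli Q) (bernoulli Q) (shiftBy k) (shiftBy (-k)) :=
  ⟨measurePreserving_shiftBy Q k, measurePreserving_shiftBy Q (-k),
    Eventually.of_forall fun y => by rw [shiftBy_shiftBy, neg_add_cancel, shiftBy_zero],
    Eventually.of_forall fun y => by rw [shiftBy_shiftBy, add_neg_cancel, shiftBy_zero]⟩

theorem nullSingletonClass_bernoulli [NullSingletonClass Q] [MeasurableSingletonClass W] :
    NullSingletonClass (bernoulli Q) := ⟨fun y => by
  refine measure_mono_null (t := (fun z : ℤ → W => z 0) ⁻¹' {y 0}) ?_ ?_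
  · rintro z rfl
    rfl
  · rw [(measurePreserving_coord Q 0).measure_preimage (measurableSet_singleton _).nullMeasurableSet]
    exact measure_singleton _⟩

/-- The σ-algebra generated by the coordinates in `S`. -/
@[reducible]
def coordAlg (W : Type*) [mW : MeasurableSpace W] (S : Set ℤ) : MeasurableSpace (ℤ → W) :=
  ⨆ i ∈ S, mW.comap fun y => y i

theorem measurable_coordAlg {S : Set ℤ} {i : ℤ} (hi : i ∈ S) :
    Measurable[coordAlg W S] fun y : ℤ → W => y i := by
  rw [measurable_iff_comap_le]
  exact le_iSup₂ (f := fun (i : ℤ) (_ : i ∈ S) => mW.comap fun y : ℤ → W => y i) i hi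

theorem coordAlg_le (S : Set ℤ) : coordAlg W S ≤ MeasurableSpace.pi :=
  iSup₂_le fun i _ => (measurable_pi_apply i).comap_le

theorem coordAlg_mono {S S' : Set ℤ} (h : S ⊆ S') : coordAlg W S ≤ coordAlg W S' :=
  biSup_mono fun _ hi => h hi

theorem measurable_shiftBy_coordAlg {S S' : Set ℤ} {k : ℤ} (h : ∀ i ∈ S, i + k ∈ S') :
    @Measurable _ _ (coordAlg W S') (coordAlg W S) (shiftBy k) := by
  rw [measurable_iff_comap_le, coordAlg, MeasurableSpace.comap_iSup]
  refine iSup_le fun i => ?_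
  rw [MeasurableSpace.comap_iSup]
  refine iSup_le fun hi => ?_
  rw [MeasurableSpace.comap_comp]
  exact (measurable_coordAlg (h i hi)).comap_le

theorem indep_coordAlg {S S' : Set ℤ} (h : Disjoint S S') :
    Indep (coordAlg W S) (coordAlg W S') (bernoulli Q) :=
  indep_iSup_of_disjoint (fun i => (measurable_pi_apply i).comap_le)
    (iIndepFun_infinitePi (P := fun _ : ℤ => Q) (X := fun _ w => w) fun _ => measurable_id) h

end Bernoulli

/-! ### A finite-memory process that follows `T` with random restarts -/

section Resampling

set_option linter.unusedSectionVars false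

variable {X : Type*} [MeasurableSpace X]

/-- The state at time `0` of the process that at each time moves by `T` or, if the coin shows
`true`, starts afresh from a random point; the memory is cut at depth `N`. -/
def resample (T : X → X) : ℕ → (ℤ → Bool × X) → X
  | 0, y => (y 0).2
  | N + 1, y => bif (y 0).1 then (y 0).2 else T (resample T N (shiftBy (-1) y))

theorem resample_succ (T : X → X) (N : ℕ) (y : ℤ → Bool × X) : resample T (N + 1) y =
    bif (y 0).1 then (y 0).2 else T (resample T N (shiftBy (-1) y)) := rfl

theorem measurable_resample {T : X → X} (hT : Measurable T) (N : ℕ) :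
    Measurable[coordAlg (Bool × X) (Icc (-N : ℤ) 0)] (resample T N) := by
  induction N with
  | zero => exact measurable_snd.comp (measurable_coordAlg (by simp))
  | succ N ih =>
    have h0 : Measurable[coordAlg (Bool × X) (Icc (-(N + 1 : ℕ) : ℤ) 0)]
        fun y : ℤ → Bool × X => y 0 :=
      measurable_coordAlg (by constructor <;> simp)
    have h1 : Measurable[coordAlg (Bool × X) (Icc (-(N + 1 : ℕ) : ℤ) 0)]
        fun y => T (resample T N (shiftBy (-1) y)) := by
      refine hT.comp (ih.comp (measurable_shiftBy_coordAlg ?_))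
      rintro i ⟨hi, hi'⟩
      constructor <;> push_cast <;> omega
    have h2 : (resample T (N + 1)) = fun y =>
        if (y 0).1 = true then (y 0).2 else T (resample T N (shiftBy (-1) y)) := by
      funext y
      rw [resample]
      cases (y 0).1 <;> rfl
    rw [h2]
    refine @Measurable.ite _ _ (_) _ _ _ _ _ ?_ (measurable_snd.comp h0) h1
    exact (measurable_fst.comp h0) (measurableSet_singleton true)

theorem measurable_resample_pi {T : X → X} (hT : Measurable T) (N : ℕ) :
    Measurable (resample T N) :=
  (measurable_resample hT N).mono (coordAlg_le _) le_rfl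

variable (κ : Measure Bool) [IsProbabilityMeasure κ] {μ : Measure X} [IsProbabilityMeasure μ]

theorem measure_coin_eq (b : Bool) (i : ℤ) :
    bernoulli (κ.prod μ) {y | (y i).1 = b} = κ {b} := by
  have h := (measurePreserving_coord (κ.prod μ) i).measure_preimage
    (s := {b} ×ˢ univ) ((measurableSet_singleton b).prod MeasurableSet.univ).nullMeasurableSet
  rw [Measure.prod_prod, measure_univ, mul_one] at h
  rw [← h]
  congr 1
  ext y
  simp

/-- The current coin is independent of the past. -/
theorem measure_coin_inter_shift (b : Bool) {N : ℕ} {D : Set (ℤ → Bool × X)}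
    (hD : MeasurableSet[coordAlg (Bool × X) (Icc (-N : ℤ) 0)] D) :
    bernoulli (κ.prod μ) ({y | (y 0).1 = b} ∩ shiftBy (-1) ⁻¹' D) =
      κ {b} * bernoulli (κ.prod μ) D := by
  have hind := indep_coordAlg (κ.prod μ) (S := {0}) (S' := Iio 0) (by simp)
  have h1 : MeasurableSet[coordAlg (Bool × X) {0}] {y : ℤ → Bool × X | (y 0).1 = b} :=
    (measurable_fst.comp (measurable_coordAlg (mem_singleton 0))) (measurableSet_singleton b)
  have h2 : MeasurableSet[coordAlg (Bool × X) (Iio 0)] (shiftBy (-1) ⁻¹' D) := by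
    refine measurable_shiftBy_coordAlg (S := Icc (-N : ℤ) 0) ?_ hD
    rintro i ⟨_, hi⟩
    rw [mem_Iio]
    omega
  rw [Indep_iff] at hind
  rw [hind _ _ h1 h2, measure_coin_eq,
    (measurePreserving_shiftBy _ _).measure_preimage (coordAlg_le _ _ hD).nullMeasurableSet]

theorem measurePreserving_resample {T : X → X} (hT : MeasurePreserving T μ μ) (N : ℕ) :
    MeasurePreserving (resample T N) (bernoulli (κ.prod μ)) μ := by
  induction N with
  | zero => exact measurePreserving_snd.comp (measurePreserving_coord (κ.prod μ) 0)
  | succ N ih =>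
    refine ⟨measurable_resample_pi hT.measurable _, Measure.ext fun C hC => ?_⟩
    rw [Measure.map_apply (measurable_resample_pi hT.measurable _) hC]
    have hpre : resample T (N + 1) ⁻¹' C =
        ((fun y : ℤ → Bool × X => y 0) ⁻¹' ({true} ×ˢ C)) ∪
        ({y | (y 0).1 = false} ∩ shiftBy (-1) ⁻¹' (resample T N ⁻¹' (T ⁻¹' C))) := by
      ext y
      rw [mem_preimage, resample]
      rcases h : (y 0).1 <;> simp [h]
    have hD : MeasurableSet[coordAlg (Bool × X) (Icc (-N : ℤ) 0)]
        (resample T N ⁻¹' (T ⁻¹' C)) := measurable_resample hT.measurable N (hT.measurable hC)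
    have hm : MeasurableSet ({y : ℤ → Bool × X | (y 0).1 = false} ∩
        shiftBy (-1) ⁻¹' (resample T N ⁻¹' (T ⁻¹' C))) :=
      ((measurable_fst.comp (measurable_pi_apply 0)) (measurableSet_singleton false)).inter
        ((measurePreserving_shiftBy (κ.prod μ) (-1)).measurable (coordAlg_le _ _ hD))
    rw [hpre, measure_union _ hm, measure_coin_inter_shift κ false hD,
      (measurePreserving_coord (κ.prod μ) 0).measure_preimage
        ((measurableSet_singleton true).prod hC).nullMeasurableSet, Measure.prod_prod,
      ih.measure_preimage (hT.measurable hC).nullMeasurableSet,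
      hT.measure_preimage hC.nullMeasurableSet, ← add_mul]
    · have h1 : κ {true} + κ {false} = 1 := by
        rw [← measure_union (by simp) (measurableSet_singleton _), ← measure_univ (μ := κ)]
        congr 1
        ext b
        cases b <;> simp
      rw [h1, one_mul]
    · refine Set.disjoint_left.2 ?_
      rintro y ⟨h1, _⟩ ⟨h2, _⟩
      rw [mem_singleton_iff] at h1
      exact absurd (h1.symm.trans h2) (by simp)

variable [StandardBorelSpace X]

/-- A restart erases the past, so two cut-offs can differ only if the coin shows `false` now and
they already differed one step earlier. The coin is independent of that earlier event. -/
theorem measure_resample_succ_ne_le {T : X → X} (hT : Measurable T) (N : ℕ) :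
    bernoulli (κ.prod μ) {y | resample T (N + 1) y ≠ resample T N y} ≤ κ {false} ^ N := by
  induction N with
  | zero => simpa using prob_le_one
  | succ N ih =>
    have hD : MeasurableSet[coordAlg (Bool × X) (Icc (-(N + 1 : ℕ) : ℤ) 0)]
        {y | resample T (N + 1) y ≠ resample T N y} := by
      refine @MeasurableSet.compl _ _ (_) (@measurableSet_eq_fun _ _ (_) _ _ _ _
        (measurable_resample hT (N + 1)) ((measurable_resample hT N).mono (coordAlg_mono ?_) le_rfl))
      refine Icc_subset_Icc ?_ le_rfl
      push_cast
      omega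
    calc bernoulli (κ.prod μ) {y | resample T (N + 1 + 1) y ≠ resample T (N + 1) y}
        ≤ bernoulli (κ.prod μ) ({y | (y 0).1 = false} ∩
          shiftBy (-1) ⁻¹' {y | resample T (N + 1) y ≠ resample T N y}) := by
          refine measure_mono fun y hy => ?_
          rw [mem_ofPred_eq, resample_succ T (N + 1), resample_succ T N y] at hy
          rcases h : (y 0).1 with _ | _
          · refine ⟨h, fun heq => hy ?_⟩
            rw [h, cond_false, cond_false]
            exact congrArg T heq
          · rw [h, cond_true, cond_true] at hy
            exact absurd rfl hy
      _ = κ {false} * bernoulli (κ.prod μ) {y | resample T (N + 1) y ≠ resample T N y} :=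
          measure_coin_inter_shift κ false hD
      _ ≤ κ {false} * κ {false} ^ N := by gcongr
      _ = κ {false} ^ (N + 1) := (pow_succ' _ _).symm

/-- The resampled process nearly follows `T`. -/
theorem measure_resample_shift_ne_le {T : X → X} (hT : Measurable T) (N : ℕ) :
    bernoulli (κ.prod μ) {y | resample T N (shiftBy 1 y) ≠ T (resample T N y)} ≤
      κ {false} ^ N + κ {true} := by
  have hD : MeasurableSet {y | resample T (N + 1) y ≠ resample T N y} :=
    (measurableSet_eq_fun (measurable_resample_pi hT _) (measurable_resample_pi hT _)).compl
  calc bernoulli (κ.prod μ) {y | resample T N (shiftBy 1 y) ≠ T (resample T N y)}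
      -- If the coin at time `1` shows `false`, the state with memory `N + 1` at time `1` is exactly
      -- `T` of the state with memory `N` at time `0`. An error thus requires a restart or a
      -- disagreement of the two cut-offs.
      ≤ bernoulli (κ.prod μ) (shiftBy 1 ⁻¹' {y | resample T (N + 1) y ≠ resample T N y} ∪
        {y | (y 1).1 = true}) := by
        refine measure_mono fun y hy => ?_
        rcases h : (y 1).1 with _ | _
        · refine Or.inl fun heq => hy ?_
          rw [← heq, resample, shiftBy_shiftBy, neg_add_cancel, shiftBy_zero]
          have : (shiftBy 1 y 0).1 = false := by simpa [shiftBy] using h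
          rw [this, cond_false]
        · exact Or.inr h
    _ ≤ _ := measure_union_le _ _
    _ ≤ _ := by
        rw [measure_coin_eq, (measurePreserving_shiftBy _ _).measure_preimage hD.nullMeasurableSet]
        gcongr
        exact measure_resample_succ_ne_le κ hT N

/-- Along a progression with a large difference the resampled process is independent. -/
theorem le_famEntropy_resample {T : X → X} (hT : MeasurePreserving T μ μ) {N j : ℕ} (hj : N < j)
    (L : ℕ) {B : Set X} (hB : MeasurableSet B) :
    L * Real.binEntropy (μ.real B) ≤ famEntropy (bernoulli (κ.prod μ))
      (fun (p : ℤ) y => indicatorLabel B (resample T N (shiftBy (-p) y))) (progression j L) := by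
  -- The label at time `p` reads only the coordinates in `[-N - p, -p]`. For multiples of `j > N`
  -- these windows are disjoint.
  have hlab : ∀ (p : ℤ) {S : Set ℤ}, Icc (-N - p : ℤ) (-p) ⊆ S →
      Measurable[coordAlg (Bool × X) S]
        fun y => indicatorLabel B (resample T N (shiftBy (-p) y)) := by
    intro p S hS
    refine (measurable_indicatorLabel hB).comp ((measurable_resample hT.measurable N).comp
      (measurable_shiftBy_coordAlg ?_))
    rintro i ⟨hi, hi'⟩
    exact hS ⟨by omega, by omega⟩
  have hmeas : ∀ p : ℤ, Measurable
      fun y : ℤ → Bool × X => indicatorLabel B (resample T N (shiftBy (-p) y)) := fun p =>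
    (hlab p (subset_univ _)).mono (coordAlg_le _) le_rfl
  induction L with
  | zero => simp [progression, famEntropy_empty]
  | succ L ih =>
    have hins : progression j (L + 1) = insert ((j * L : ℕ) : ℤ) (progression j L) := by
      rw [progression, Finset.range_add_one, Finset.image_insert]
      rfl
    have hind : IndepFun
        (fun y : ℤ → Bool × X => indicatorLabel B (resample T N (shiftBy (-((j * L : ℕ) : ℤ)) y)))
        (fun y (p : progression j L) => indicatorLabel B (resample T N (shiftBy (-(p : ℤ)) y)))
        (bernoulli (κ.prod μ)) := by
      refine indep_of_indep_of_le_left (indep_of_indep_of_le_right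
        (indep_coordAlg (κ.prod μ) (S := Iic (-((j * L : ℕ) : ℤ))) (S' := Ioi (-((j * L : ℕ) : ℤ)))
          (Iic_disjoint_Ioi le_rfl)) (Measurable.comap_le ?_)) (Measurable.comap_le ?_)
      · refine @measurable_pi_lambda _ _ _ (_) _ _ fun p => hlab p ?_
        obtain ⟨k, hk, hkp⟩ := Finset.mem_image.1 p.2
        rw [← hkp]
        rintro i ⟨hi, _⟩
        rw [mem_Ioi]
        have h1 : j * (k + 1) ≤ j * L := Nat.mul_le_mul_left j (Finset.mem_range.1 hk)
        rw [Nat.mul_succ] at h1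
        omega
      · exact hlab _ fun i hi => hi.2
    have hent : partEntropy (bernoulli (κ.prod μ)) (fun y : ℤ → Bool × X =>
        indicatorLabel B (resample T N (shiftBy (-((j * L : ℕ) : ℤ)) y))) =
        Real.binEntropy (μ.real B) := by
      rw [← partEntropy_indicatorLabel hB]
      exact partEntropy_comp_measurePreserving
        ((measurePreserving_resample κ hT N).comp (measurePreserving_shiftBy (κ.prod μ) _))
        (measurable_indicatorLabel hB)
    have h1 := add_famEntropy_le_famEntropy_insert hmeas hind
    rw [hins]
    refine le_trans ?_ h1
    rw [hent]
    push_cast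
    linarith

end Resampling

/-! ### Density of automorphisms with independence along sparse progressions -/

section Density

variable {X : Type*} [MeasurableSpace X] [StandardBorelSpace X] {μ : Measure X}
  [IsProbabilityMeasure μ] [NullSingletonClass μ]

theorem exists_coin {δ : ℝ} (hδ : 0 < δ) :
    ∃ κ : Measure Bool, IsProbabilityMeasure κ ∧
      ∃ N : ℕ, κ {false} ^ N + κ {true} ≤ ENNReal.ofReal δ := by
  let c : ℝ := min (δ / 2) (1 / 2)
  have hc0 : 0 < c := lt_min (by positivity) (by norm_num)
  have hc1 : c ≤ 1 / 2 := min_le_right _ _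
  have hc2 : c ≤ δ / 2 := min_le_left _ _
  -- Restarts with probability `c ≤ δ / 2` contribute one half of the error, and a memory with `(1 -
  -- c) ^ N < δ / 2` the other.
  obtain ⟨N, hN⟩ := exists_pow_lt_of_lt_one (half_pos hδ) (by linarith : 1 - c < 1)
  refine ⟨ENNReal.ofReal c • Measure.dirac true + ENNReal.ofReal (1 - c) • Measure.dirac false,
    ⟨?_⟩, N, ?_⟩
  · simp only [Measure.coe_add, Measure.coe_smul, Pi.add_apply, Pi.smul_apply, measure_univ,
      smul_eq_mul, mul_one]
    rw [← ENNReal.ofReal_add hc0.le (by linarith)]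
    simp
  · simp only [Measure.coe_add, Measure.coe_smul, Pi.add_apply, Pi.smul_apply, smul_eq_mul,
      Measure.dirac_apply, indicator, mem_singleton_iff, Pi.one_apply]
    simp only [reduceCtorEq, if_false, if_true, mul_zero, mul_one, zero_add, add_zero]
    rw [← ENNReal.ofReal_pow (by linarith), ← ENNReal.ofReal_add (pow_nonneg (by linarith) N) hc0.le]
    exact ENNReal.ofReal_le_ofReal (by linarith)

/-- Given measure-preserving maps to `X` can be matched with isomorphisms on finitely many sets. -/
theorem exists_aeIso_of_finite {Y : Type*} [MeasurableSpace Y] [StandardBorelSpace Y]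
    {ν : Measure Y} [IsProbabilityMeasure ν] [NullSingletonClass ν] {Z : Y → X}
    (hZ : MeasurePreserving Z ν μ) {ι : Type*} [Finite ι] {D : ι → Set X}
    (hD : ∀ i, MeasurableSet (D i)) :
    ∃ (φ : Y → X) (ψ : X → Y), AEIso ν μ φ ψ ∧ ∀ᵐ y ∂ν, ∀ i, φ y ∈ D i ↔ Z y ∈ D i := by
  obtain ⟨e, he⟩ := exists_injective_nat (ι → Prop)
  -- The label encodes the membership pattern of a point in all the sets `D i` at once.
  let q : X → ℕ := fun x => e fun i => x ∈ D i
  have hq : Measurable q := (measurable_of_countable e).comp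
    (measurable_pi_lambda _ fun i => measurableSet_setOfPred.1 (hD i))
  obtain ⟨φ, ψ, h, hφ⟩ := exists_aeIso_of_map_eq (P := ν) (P' := μ) (q := fun y => q (Z y))
    (hq.comp hZ.measurable) hq fun s =>
      hZ.measure_preimage (hq (MeasurableSet.of_discrete (s := s))).nullMeasurableSet
  refine ⟨φ, ψ, h, ?_⟩
  filter_upwards [hφ] with y hy i
  exact Iff.of_eq (congrFun (he hy) i)

/-- Every automorphism can be approximated, on finitely many sets, by an automorphism under which
these sets become independent along progressions with a large difference. -/
theorem exists_approx_independent (T₀ : mpGroup μ) {δ : ℝ} (hδ : 0 < δ) {ι : Type*} [Finite ι]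
    {D : ι → Set X} (hD : ∀ i, MeasurableSet (D i)) :
    ∃ T : mpGroup μ,
      (∀ i, μ.real (((T : Equiv.Perm X) ⁻¹' D i) ∆ ((T₀ : Equiv.Perm X) ⁻¹' D i)) ≤ δ) ∧
      ∃ N : ℕ, ∀ j, N < j → ∀ (L : ℕ) (i : ι), L * Real.binEntropy (μ.real (D i)) ≤
        joinEntropy (T : Aut μ) (progression j L) (indicatorLabel (D i)) := by
  obtain ⟨κ, hκ, N, hN⟩ := exists_coin hδ
  let ν : Measure (ℤ → Bool × X) := bernoulli (κ.prod μ)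
  have : NullSingletonClass ν := nullSingletonClass_bernoulli (κ.prod μ)
  let T₀f : X → X := (T₀ : Equiv.Perm X)
  have hT₀ : MeasurePreserving T₀f μ μ := mpGroup_mp T₀
  let Z : (ℤ → Bool × X) → X := resample T₀f N
  have hZ : MeasurePreserving Z ν μ := measurePreserving_resample κ hT₀ N
  -- `Z` itself need not be injective. It is replaced by an isomorphism `φ` that agrees with it on
  -- the sets `D i`, and also on their preimages under `T₀`, which are needed to compare `T` with
  -- `T₀`.
  obtain ⟨φ, ψ, hφ, hφD⟩ := exists_aeIso_of_finite hZ
    (D := Sum.elim D fun i => T₀f ⁻¹' D i) (by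
      rintro (i | i)
      · exact hD i
      · exact hT₀.measurable (hD i))
  have hσ := fun k => (measurePreserving_shiftBy (κ.prod μ) k).quasiMeasurePreserving
  -- `T` is the shift transported to `X`, that is `φ ∘ shift ∘ ψ` almost everywhere.
  obtain ⟨T, hT⟩ := ((hφ.symm.trans (aeIso_shiftBy (κ.prod μ) 1)).trans hφ).exists_mpGroup
  have hTφ : ∀ᵐ y ∂ν, (T : Equiv.Perm X) (φ y) = φ (shiftBy 1 y) := by
    filter_upwards [hφ.mp.quasiMeasurePreserving.ae hT, hφ.left_inv] with y h1 h2
    rw [h1, h2]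
  have hTinv : ∀ᵐ y ∂ν, ((T⁻¹ : mpGroup μ) : Equiv.Perm X) (φ y) = φ (shiftBy (-1) y) := by
    filter_upwards [(hσ (-1)).ae hTφ] with y h
    rw [shiftBy_shiftBy, add_neg_cancel, shiftBy_zero] at h
    change (T : Equiv.Perm X).symm (φ y) = _
    rw [Equiv.symm_apply_eq, h]
  have hTpow : ∀ k : ℕ, ∀ᵐ y ∂ν,
      ((T ^ (-(k : ℤ)) : mpGroup μ) : Equiv.Perm X) (φ y) = φ (shiftBy (-(k : ℤ)) y) := by
    intro k
    induction k with
    | zero => exact Eventually.of_forall fun y => by simp [shiftBy_zero]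
    | succ k ih =>
      filter_upwards [ih, (hσ (-(k : ℤ))).ae hTinv] with y h1 h2
      have h3 : T ^ (-((k + 1 : ℕ) : ℤ)) = T⁻¹ * T ^ (-(k : ℤ)) := by
        push_cast
        rw [← zpow_neg_one, ← zpow_add]
        congr 1
        ring
      rw [h3]
      change ((T⁻¹ : mpGroup μ) : Equiv.Perm X) (((T ^ (-(k : ℤ)) : mpGroup μ) : Equiv.Perm X)
        (φ y)) = _
      rw [h1, h2, shiftBy_shiftBy]
      congr 2
      push_cast
      ring
  refine ⟨T, fun i => ?_, N, fun j hj L i => ?_⟩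
  · have hTi : MeasurableSet ((T : Equiv.Perm X) ⁻¹' D i) := (mpGroup_mp T).measurable (hD i)
    rw [← hφ.mp.measureReal_preimage
      (hTi.symmDiff (hT₀.measurable (hD i))).nullMeasurableSet]
    refine ENNReal.toReal_le_of_le_ofReal hδ.le (le_trans (measure_mono_ae ?_)
      ((measure_resample_shift_ne_le κ hT₀.measurable N).trans hN))
    -- Where the process follows `T₀`, the point `T (φ y)` lies in `D i` iff `Z (shiftBy 1 y) = T₀
    -- (Z y)` does, and this holds iff `φ y` lies in the preimage of `D i` under `T₀`.
    filter_upwards [hTφ, hφD, (hσ 1).ae hφD] with y h1 h2 h3 hy heq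
    have h4 := h3 (Sum.inl i)
    have h5 := h2 (Sum.inr i)
    simp only [Sum.elim_inl, Sum.elim_inr, mem_preimage] at h4 h5
    change φ y ∈ ((T : Equiv.Perm X) ⁻¹' D i) ∆ (T₀f ⁻¹' D i) at hy
    rw [mem_symmDiff, mem_preimage, mem_preimage, h1, h4, h5] at hy
    change resample T₀f N (shiftBy 1 y) = T₀f (resample T₀f N y) at heq
    rw [show Z (shiftBy 1 y) = T₀f (Z y) from heq] at hy
    tauto
  · refine (le_famEntropy_resample κ hT₀ hj L (hD i)).trans_eq ?_
    have hm : Measurable (joinLabel T (progression j L) (indicatorLabel (D i))) :=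
      measurable_fam (measurable_iterate T (measurable_indicatorLabel (hD i))) _
    change _ = partEntropy μ (joinLabel T (progression j L) (indicatorLabel (D i)))
    rw [← partEntropy_comp_measurePreserving hφ.mp hm, famEntropy_eq]
    refine partEntropy_congr ?_
    have hall : ∀ p : progression j L, ∀ᵐ y ∂ν,
        indicatorLabel (D i) (resample T₀f N (shiftBy (-(p : ℤ)) y)) =
          indicatorLabel (D i) (((T ^ (-(p : ℤ)) : mpGroup μ) : Equiv.Perm X) (φ y)) := by
      intro p
      obtain ⟨k, hk⟩ := Int.eq_ofNat_of_zero_le (progression_nonneg j L p p.2)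
      rw [hk]
      filter_upwards [hTpow k, (hσ (-(k : ℤ))).ae hφD] with y h1 h2
      have h3 := h2 (Sum.inl i)
      simp only [Sum.elim_inl] at h3
      rw [h1]
      simp only [indicatorLabel]
      rw [h3]
    filter_upwards [ae_all_iff.2 hall] with y hy
    exact funext hy

/-- Automorphisms under which a given set becomes independent along progressions with a large
difference are dense. -/
theorem exists_halmosDist_lt_independent (A : ℕ → MeasuredSets μ) (T₀ : Aut μ) {B : Set X}
    (hB : MeasurableSet B) {ε : ℝ} (hε : 0 < ε) :
    ∃ T : Aut μ, halmosDist A T T₀ < ε ∧ ∃ N : ℕ, ∀ j, N < j → ∀ L : ℕ,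
      L * Real.binEntropy (μ.real B) ≤ joinEntropy T (progression j L) (indicatorLabel B) := by
  induction T₀ using QuotientGroup.induction_on with | H T₀ => ?_
  have h := fun M : ℕ => exists_approx_independent T₀ (δ := 1 / ((M : ℝ) + 1)) (by positivity)
    -- The sets `A i` control the inverse images. For the images, `T A i ∆ T₀ A i` is pulled back by
    -- `T`, which compares the preimages of `T₀ A i` under `T` and `T₀`. The value `none` carries
    -- `B`.
    (D := fun o : Option (Fin M × Bool) => o.elim B fun i =>
      bif i.2 then (A i.1 : Set X) else (T₀ : Equiv.Perm X) '' (A i.1 : Set X)) (by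
      rintro (_ | ⟨i, _ | _⟩)
      · exact hB
      · exact measurableSet_image T₀ (measurableSet_coe (A i))
      · exact measurableSet_coe (A i))
  choose T hT N hN using h
  have hlim : Tendsto (fun M => halmosDist A (T M : Aut μ) (T₀ : Aut μ)) atTop (𝓝 0) := by
    refine tendsto_halmosDist A (fun i => ?_) fun i => ?_
    · refine tendsto_of_tendsto_of_tendsto_of_le_of_le' tendsto_const_nhds
        (tendsto_one_div_add_atTop_nhds_zero_nat (𝕜 := ℝ))
        (Eventually.of_forall fun M => moveDist_nonneg _ _ _) ?_
      filter_upwards [eventually_gt_atTop i] with M hM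
      have h1 := hT M (some (⟨i, hM⟩, false))
      simp only [Option.elim_some, cond_false] at h1
      refine le_of_eq_of_le ?_ h1
      rw [moveDist_mk, ← (mpGroup_mp (T M)).measureReal_preimage
        ((measurableSet_image (T M) (measurableSet_coe (A i))).symmDiff
          (measurableSet_image T₀ (measurableSet_coe (A i)))).nullMeasurableSet, preimage_symmDiff,
        preimage_image_eq _ (T M : Equiv.Perm X).injective,
        preimage_image_eq _ (T₀ : Equiv.Perm X).injective, symmDiff_comm]
    · refine tendsto_of_tendsto_of_tendsto_of_le_of_le' tendsto_const_nhds
        (tendsto_one_div_add_atTop_nhds_zero_nat (𝕜 := ℝ))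
        (Eventually.of_forall fun M => moveDist_nonneg _ _ _) ?_
      filter_upwards [eventually_gt_atTop i] with M hM
      have h1 := hT M (some (⟨i, hM⟩, true))
      simp only [Option.elim_some, cond_true] at h1
      rwa [moveDist_inv_mk]
  obtain ⟨M, hM⟩ := (hlim.eventually_lt_const hε).exists
  exact ⟨T M, hM, N M, fun j hj L => hN M j hj L none⟩

theorem exists_measureReal_eq_half (μ : Measure X) [IsProbabilityMeasure μ]
    [NullSingletonClass μ] : ∃ B : Set X, MeasurableSet B ∧ μ.real B = 2⁻¹ := by
  obtain ⟨g, f, h, _⟩ := exists_aeIso_unit (P := μ) (q := fun _ => 0) measurable_const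
  refine ⟨f ⁻¹' Iio 2⁻¹, h.mp_inv.measurable measurableSet_Iio, ?_⟩
  rw [h.mp_inv.measureReal_preimage measurableSet_Iio.nullMeasurableSet, measureReal_def,
    Measure.restrict_apply measurableSet_Iio]
  have : Iio (2⁻¹ : ℝ) ∩ Ioo 0 1 = Ioo 0 2⁻¹ := by
    ext t
    simp only [mem_inter_iff, mem_Iio, mem_Ioo]
    constructor
    · rintro ⟨h1, h2, _⟩
      exact ⟨h2, h1⟩
    · rintro ⟨h1, h2⟩
      exact ⟨h2, h1, h2.trans (by norm_num)⟩
  rw [this, Real.volume_Ioo]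
  norm_num

end Density

/-! ### The conjugates form a meagre set -/

section Category

variable {X : Type*} [MeasurableSpace X] [StandardBorelSpace X] {μ : Measure X}
  [IsProbabilityMeasure μ]

/-- The product of the lengths found for the sets `A 0, …, A j` is a multiple of each of them. -/
theorem exists_progression_length (A : ℕ → MeasuredSets μ) (hA : DenseRange A)
    {K : Set (Aut μ)} (hKE : K ⊆ zeroEntropy μ) (hK : letI := halmosMetric A hA; IsCompact K)
    (j : ℕ) : ∃ L : ℕ, 0 < L ∧ ∀ i ≤ j, ∀ S ∈ K,
      joinEntropy S (progression (j + 1) L) (indicatorLabel (A i : Set X)) <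
        1 / ((j : ℝ) + 1) * L := by
  choose L hL h using fun i => exists_uniform_joinEntropy_lt A hA hKE hK
    (measurable_indicatorLabel (measurableSet_coe (A i))) (Nat.succ_pos j)
    (by positivity : (0 : ℝ) < 1 / ((j : ℝ) + 1))
  have hpos : 0 < ∏ i ∈ Finset.range (j + 1), L i := Finset.prod_pos fun i _ => hL i
  refine ⟨∏ i ∈ Finset.range (j + 1), L i, hpos, fun i hi S hS => ?_⟩
  obtain ⟨m, hm⟩ := Finset.dvd_prod_of_mem L (Finset.mem_range.2 (Nat.lt_succ_of_le hi))
  rw [hm, mul_comm (L i)] at hpos ⊢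
  exact h i m (Nat.pos_of_mul_pos_right hpos) S hS

/-- A conjugate of an element of `K` has small entropy along the chosen progressions. -/
theorem eventually_joinEntropy_conj_le (A : ℕ → MeasuredSets μ) (hA : DenseRange A)
    {K : Set (Aut μ)} {L : ℕ → ℕ}
    (hL : ∀ j, ∀ i ≤ j, ∀ S ∈ K,
      joinEntropy S (progression (j + 1) (L j)) (indicatorLabel (A i : Set X)) <
        1 / ((j : ℝ) + 1) * L j)
    {T : Aut μ} (hT : T ∈ conjugates K) {B : Set X} (hB : MeasurableSet B) {c : ℝ} (hc : 0 < c) :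
    ∀ᶠ j in atTop, joinEntropy T (progression (j + 1) (L j)) (indicatorLabel B) ≤ L j * c := by
  obtain ⟨S, hS, J, rfl⟩ := hT
  obtain ⟨J, rfl⟩ := QuotientGroup.mk_surjective J
  have hJB := measurableSet_image J hB
  have hbin : ∀ᶠ d in 𝓝 (0 : ℝ), Real.binEntropy d < c / 2 := by
    refine Real.binEntropy_continuous.continuousAt.eventually_lt_const ?_
    rw [Real.binEntropy_zero]
    positivity
  obtain ⟨η, hη, hbin⟩ := Metric.eventually_nhds_iff.1 hbin
  obtain ⟨i, hi⟩ := Metric.denseRange_iff.1 hA ⟨_, hJB⟩ η hη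
  change μ.real (((J : Equiv.Perm X) '' B) ∆ (A i : Set X)) < η at hi
  have hd := @hbin (μ.real (((J : Equiv.Perm X) '' B) ∆ (A i : Set X)))
    (by rwa [Real.dist_0_eq_abs, abs_of_nonneg measureReal_nonneg])
  filter_upwards [eventually_ge_atTop i,
    (tendsto_one_div_add_atTop_nhds_zero_nat (𝕜 := ℝ)).eventually_lt_const (half_pos hc)]
    with j hij hj
  rw [joinEntropy_conj J S _ hB]
  refine (joinEntropy_indicatorLabel_le S _ hJB (measurableSet_coe (A i))).trans ?_
  have h1 := hL j i hij S hS
  have h2 : ((progression (j + 1) (L j)).card : ℝ) ≤ L j := by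
    exact_mod_cast progression_card_le _ _
  have h3 : (0 : ℝ) ≤ L j := Nat.cast_nonneg _
  have h4 : ((progression (j + 1) (L j)).card : ℝ) *
      Real.binEntropy (μ.real (((J : Equiv.Perm X) '' B) ∆ (A i : Set X))) ≤ L j * (c / 2) :=
    mul_le_mul h2 hd.le (Real.binEntropy_nonneg measureReal_nonneg measureReal_le_one) h3
  have h5 : 1 / ((j : ℝ) + 1) * L j ≤ c / 2 * L j := mul_le_mul_of_nonneg_right hj.le h3
  linarith

variable [NullSingletonClass μ]

theorem isMeagre_conjugates (A : ℕ → MeasuredSets μ) (hA : DenseRange A) {K : Set (Aut μ)}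
    (hKE : K ⊆ zeroEntropy μ) (hK : letI := halmosMetric A hA; IsCompact K) :
    letI := halmosMetric A hA; IsMeagre (conjugates K) := by
  let _ := halmosMetric A hA
  choose L hL0 hL using exists_progression_length A hA hKE hK
  obtain ⟨B, hB, hBhalf⟩ := exists_measureReal_eq_half μ
  have hlog : 0 < Real.log 2 := Real.log_pos (by norm_num)
  -- The intersection of the `U n` says that the lower bound holds for infinitely many `j`. The
  -- constant `log 2 / 2` leaves room below `log 2`, the entropy of `{B, Bᶜ}`, so that the
  -- inequality is strict and open.
  let U : ℕ → Set (Aut μ) := fun n => ⋃ j ≥ n, {T | (L j : ℝ) * (Real.log 2 / 2) <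
    joinEntropy T (progression (j + 1) (L j)) (indicatorLabel B)}
  have hUo : ∀ n, IsOpen (U n) := fun n => isOpen_biUnion fun j _ =>
    isOpen_lt continuous_const
      (continuous_joinEntropy A hA (progression_nonneg _ _) (measurable_indicatorLabel hB))
  have hUd : ∀ n, Dense (U n) := by
    intro n
    rw [Metric.dense_iff]
    intro T₀ ε hε
    obtain ⟨T, hT, N, hN⟩ := exists_halmosDist_lt_independent A T₀ hB hε
    refine ⟨T, hT, ?_⟩
    -- The index `max n N` is at least `n`, and its step `max n N + 1` exceeds the memory bound `N`.
    have h1 := hN (max n N + 1) (Nat.lt_succ_of_le (le_max_right n N)) (L (max n N))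
    rw [hBhalf, Real.binEntropy_two_inv] at h1
    refine mem_iUnion₂.2 ⟨max n N, le_max_left n N, lt_of_lt_of_le ?_ h1⟩
    have h2 : (0 : ℝ) < L (max n N) := by exact_mod_cast hL0 _
    exact mul_lt_mul_of_pos_left (half_lt_self hlog) h2
  have hres : (⋂ n, U n) ∈ residual (Aut μ) :=
    countable_iInter_mem.2 fun n => residual_of_dense_open (hUo n) (hUd n)
  refine mem_of_superset hres fun T hT hTK => ?_
  obtain ⟨n, hn⟩ := eventually_atTop.1
    (eventually_joinEntropy_conj_le A hA hL hTK hB (half_pos hlog))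
  obtain ⟨j, hj, hlt⟩ := mem_iUnion₂.1 (mem_iInter.1 hT n)
  exact absurd (hn j hj) (not_le.2 hlt)

end Category

end ErgodicAut

theorem theorem7p2 {X : Type*} [MeasurableSpace X] [StandardBorelSpace X]
    (μ : MeasureTheory.Measure X) [MeasureTheory.IsProbabilityMeasure μ]
    [MeasureTheory.NullSingletonClass μ]
    (A : ℕ → MeasureTheory.MeasuredSets μ) (hA : DenseRange A)
    (K : Set (ErgodicAut.Aut μ)) (hKE : K ⊆ ErgodicAut.zeroEntropy μ)
    (hK : letI := ErgodicAut.halmosMetric A hA; IsCompact K) :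
    letI := ErgodicAut.halmosMetric A hA
    IsMeagre (ErgodicAut.conjugates K) ∧ ¬ ErgodicAut.IsTypical (ErgodicAut.conjugates K) := by
  let _ := ErgodicAut.halmosMetric A hA
  have hmeagre : IsMeagre (ErgodicAut.conjugates K) :=
    ErgodicAut.isMeagre_conjugates A hA hKE hK
  refine ⟨hmeagre, fun htyp => ?_⟩
  have : CompleteSpace (ErgodicAut.Aut μ) := ErgodicAut.completeSpace_halmosMetric A hA
  -- If the conjugates were also typical, the empty set would be residual, hence dense by Baire's
  -- theorem.
  have hres := Filter.inter_mem hmeagre htyp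
  rw [Set.inter_compl_self] at hres
  obtain ⟨T, hT⟩ := (dense_of_mem_residual hres).nonempty
  exact hT
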